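/- Write $e(x)=\exp(2\pi i x)$ and let $m\sim M$ denote the condition $M<m\le 2M$ on an integer $m$. For $X\ge 1$ and $0<\sigma<1/6$ put $Q=X^{4\sigma}$, \[ \mathfrak M(Q)=\bigcup_{1\le q\le Q}\ \bigcup_{\substack{1\le a\le q\\ (a,q)=1}}\Big[\frac aq-\frac{Q}{qX^2},\ \frac aq+\frac{Q}{qX^2}\Big],\qquad \mathfrak m_\sigma=\big[QX^{-2},\,1+QX^{-2}\big]\setminus\mathfrak M(Q). \] Let $0<\sigma<1/6$, $\varepsilon>0$ and $A,B$ be fixed. Then there is a constant $C$, depending only on $\sigma,\varepsilon,A,B$, such that the following holds. Let $X\ge 1$ and $R,S>0$ be real numbers with \[ R\le B X^{1-3\sigma}\qquad\text{and}\qquad RS^2\le 0.1\,X^{1-2\sigma}, \] let $\alpha\in\mathfrak m_\sigma$, and let $\xi_{r,s}$ be complex numbers with $|\xi_{r,s}|\le A(rs)^{\varepsilon}$ for all integers $r\sim R$, $s\sim S$. Then \[ \Big|\sum_{r\sim R}\ \sum_{s\sim S}\ \sum_{rsm\sim X}\xi_{r,s}\,e(\alpha r^2s^2m^2)\Big|\le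 C\,X^{1-\sigma+\varepsilon}. \] -/

import Mathlib

namespace TripleSum

noncomputable section

/-- `e(x) = exp(2πix)`. -/
def e (x : ℝ) : ℂ := Complex.exp (2 * Real.pi * Complex.I * x)

/-- The natural numbers `n ∼ M`, i.e. `M < n ≤ 2M` (for `M ≥ 0`). -/
def dyadic (M : ℝ) : Finset ℕ := Finset.Ioc ⌊M⌋₊ ⌊2 * M⌋₊

theorem mem_dyadic {M : ℝ} (hM : 0 ≤ M) (n : ℕ) :
    n ∈ dyadic M ↔ M < n ∧ (n : ℝ) ≤ 2 * M := by
  rw [dyadic, Finset.mem_Ioc, Nat.floor_lt hM, Nat.le_floor_iff (by positivity)]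

/-- For positive `r, s`, the range `m ∼ X / (rs)` is exactly the range `rsm ∼ X`. -/
theorem mem_dyadic_div {X : ℝ} (hX : 0 ≤ X) {r s : ℕ} (hr : 0 < r) (hs : 0 < s) (m : ℕ) :
    m ∈ dyadic (X / (r * s)) ↔ X < r * s * m ∧ (r * s * m : ℝ) ≤ 2 * X := by
  have h : (0 : ℝ) < r * s := by positivity
  rw [mem_dyadic (by positivity), div_lt_iff₀ h, ← mul_div_assoc, le_div_iff₀ h,
    mul_comm (m : ℝ) (r * s : ℝ)]

/-- The major arcs `𝔐(Q)` at scale `X`: the union of the intervals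
`[a/q - Q/(qX²), a/q + Q/(qX²)]` over `1 ≤ a ≤ q ≤ Q` with `(a, q) = 1`. -/
def majorArcs (X Q : ℝ) : Set ℝ :=
  {α | ∃ q a : ℕ, (q : ℝ) ≤ Q ∧ 1 ≤ a ∧ a ≤ q ∧ Nat.Coprime a q ∧
    α ∈ Set.Icc ((a : ℝ) / q - Q / (q * X ^ 2)) ((a : ℝ) / q + Q / (q * X ^ 2))}

/-- The minor arcs `𝔪_σ = [Q X⁻², 1 + Q X⁻²] \ 𝔐(Q)` with `Q = X^{4σ}`. -/
def minorArcs (σ X : ℝ) : Set ℝ :=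
  Set.Icc (X ^ (4 * σ) / X ^ 2) (1 + X ^ (4 * σ) / X ^ 2) \ majorArcs X (X ^ (4 * σ))

/-- `∑_{r ∼ R} ∑_{s ∼ S} ∑_{rsm ∼ X} ξ_{r,s} e(α r² s² m²)`. -/
def tripleSum (α X R S : ℝ) (ξ : ℕ → ℕ → ℂ) : ℂ :=
  ∑ r ∈ dyadic R, ∑ s ∈ dyadic S, ∑ m ∈ dyadic (X / (r * s)),
    ξ r s * e (α * (r : ℝ) ^ 2 * (s : ℝ) ^ 2 * (m : ℝ) ^ 2)

end

end TripleSum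

namespace TripleSum

/-! Put P = X^σ and W = P²/2. The size of a quadratic sum is governed by `kappa β Y`, which measures
how well β is approximated by fractions of small denominator at scale Y. Weyl's inequality bounds
the sum over m ∼ M by X^δ · M / √(min(κ, W)), with β = r²s²α and M = X/(rs)
(`norm_sum_dyadic_e_sq_le`). It remains to average 1/√(min(κ, W)) over s and then over r.

Over s: a good approximation to s²β forces one to β, with loss gcd(q, s)² for one fixed q
(`min_kappa_le_gcd_sq_mul`). The square root of this loss averages to a divisor function, so s costs
only X^δ.

Over r: if R²P² is small against X, the same descent leads from r²α to α, and the minor arc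
condition gives κ(α, X) ≥ W. Otherwise R ≫ P². Two values r₁ > r₂ with small κ and the same
denominator k make k(r₁² - r₂²)α nearly an integer. A divisor bound and a count of such multiples of
α show that κ < K for only about √K · R/P values of r (`card_filter_kappa_lt_le`). In both cases the
average is R/P up to X^δ.

Altogether this gives X^{3δ} · X/(RS) · S · R/P = X^{3δ} · X/P. The coefficients contribute at most
a constant times (X/P²)^ε, and the factor P^{-2ε} gained there pays for X^{3δ}. -/

/-! ### The divisor bound. -/

theorem exists_add_one_le_mul_two_pow_rpow {δ : ℝ} (hδ : 0 < δ) :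
    ∃ C : ℝ, 1 ≤ C ∧ ∀ J : ℕ, (J + 1 : ℝ) ≤ C * ((2 : ℝ) ^ J) ^ δ := by
  have hl : 0 < δ * Real.log 2 := mul_pos hδ (Real.log_pos (by norm_num))
  refine ⟨1 + 1 / (δ * Real.log 2), by linarith [one_div_pos.mpr hl], fun J => ?_⟩
  have h1 : ((2 : ℝ) ^ J) ^ δ = Real.exp (J * (δ * Real.log 2)) := by
    rw [Real.rpow_def_of_pos (by positivity), Real.log_pow]
    ring_nf
  have h2 : (J : ℝ) * (δ * Real.log 2) + 1 ≤ ((2 : ℝ) ^ J) ^ δ := h1 ▸ Real.add_one_le_exp _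
  calc (J + 1 : ℝ) ≤ (1 + 1 / (δ * Real.log 2)) * (J * (δ * Real.log 2) + 1) := by
        have : (1 + 1 / (δ * Real.log 2)) * (J * (δ * Real.log 2) + 1)
            = J + 1 + (J * (δ * Real.log 2) + 1 / (δ * Real.log 2)) := by
          field_simp; ring
        rw [this]
        have : 0 ≤ (J * (δ * Real.log 2) + 1 / (δ * Real.log 2)) := by positivity
        linarith
    _ ≤ _ := by gcongr

/-- The divisor bound `τ(n) ≪ n ^ δ`. -/
theorem exists_card_divisors_le {δ : ℝ} (hδ : 0 < δ) :
    ∃ C : ℝ, 1 ≤ C ∧ ∀ n : ℕ, (n.divisors.card : ℝ) ≤ C * (n : ℝ) ^ δ := by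
  obtain ⟨c, hc1, hc⟩ := exists_add_one_le_mul_two_pow_rpow hδ
  -- A prime p ≥ P has p^δ ≥ 2, so k + 1 ≤ 2^k ≤ p^{kδ} without loss. Only the fewer than P + 1
  -- smaller primes cost a factor c each.
  set P : ℕ := ⌈(2 : ℝ) ^ (1 / δ)⌉₊ with hP
  refine ⟨c ^ P, one_le_pow₀ hc1, fun n => ?_⟩
  rcases eq_or_ne n 0 with rfl | hn
  · simp only [Nat.divisors_zero, Finset.card_empty, Nat.cast_zero]
    positivity
  have key : ∀ p ∈ n.primeFactors, ((n.factorization p : ℝ) + 1)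
      ≤ (if p < P then c else 1) * ((p : ℝ) ^ n.factorization p) ^ δ := by
    intro p hp
    have hp2 : (2 : ℝ) ≤ p := by exact_mod_cast (Nat.prime_of_mem_primeFactors hp).two_le
    split_ifs with h
    · refine (hc _).trans ?_
      gcongr
    · have h3 : (2 : ℝ) ^ (1 / δ) ≤ p := (Nat.le_ceil _).trans (by exact_mod_cast not_lt.mp h)
      have h4 : (2 : ℝ) ≤ (p : ℝ) ^ δ := by
        calc (2 : ℝ) = ((2 : ℝ) ^ (1 / δ)) ^ δ := by
              rw [← Real.rpow_mul (by norm_num), one_div_mul_cancel hδ.ne', Real.rpow_one]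
          _ ≤ _ := by gcongr
      rw [one_mul, ← Real.rpow_natCast, ← Real.rpow_mul (by positivity), mul_comm,
        Real.rpow_mul (by positivity), Real.rpow_natCast]
      calc ((n.factorization p : ℝ) + 1) ≤ 2 ^ n.factorization p := by
            exact_mod_cast Nat.lt_two_pow_self
        _ ≤ _ := by gcongr
  have hprod : (n : ℝ) ^ δ = ∏ p ∈ n.primeFactors, ((p : ℝ) ^ n.factorization p) ^ δ := by
    rw [Real.finsetProd_rpow _ _ (fun i _ => by positivity)]
    congr 1
    conv_lhs => rw [← Nat.prod_factorization_pow_eq_self hn]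
    rw [Finsupp.prod, Nat.support_factorization]
    push_cast
    rfl
  rw [Nat.card_divisors hn, hprod]
  push_cast
  refine (Finset.prod_le_prod (fun i _ => by positivity) key).trans ?_
  rw [Finset.prod_mul_distrib]
  gcongr
  rw [Finset.prod_ite, Finset.prod_const_one, mul_one, Finset.prod_const]
  refine pow_le_pow_right₀ hc1 ?_
  calc _ ≤ (Finset.range P).card := Finset.card_le_card fun p hp => by
        simpa using (Finset.mem_filter.mp hp).2
    _ = P := Finset.card_range P

/-! ### Multiples of α near integers, and Dirichlet approximation. -/

/-- If the multiples `dα`, `0 < d < L`, are at distance at least `δ` from the integers, then few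
multiples of `α` are close to an integer. -/
theorem card_filter_near_le_of_spaced {α δ Δ : ℝ} {L : ℕ} (N : ℕ) (hL : 0 < L) (hδ : 0 < δ)
    (hΔ : 0 ≤ Δ) (h : ∀ d : ℕ, 0 < d → d < L → ∀ z : ℤ, δ ≤ |d * α - z|) :
    (((Finset.range (N + 1)).filter fun n : ℕ => |n * α - round (n * α)| ≤ Δ).card : ℝ)
      ≤ (N / L + 1) * (2 * Δ / δ + 1) := by
  set T := (Finset.range (N + 1)).filter fun n : ℕ => |n * α - round (n * α)| ≤ Δ with hT
  let x : ℕ → ℝ := fun n => n * α - round (n * α)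
  -- Pigeonhole: the boxes are blocks of L consecutive n times cells of width δ for the signed
  -- distance. Two n in one box would give some d < L with dα closer than δ to an integer.
  let f : ℕ → ℕ × ℕ := fun n => (n / L, ⌊(x n + Δ) / δ⌋₊)
  have hx : ∀ n ∈ T, |x n| ≤ Δ := fun n hn => (Finset.mem_filter.mp hn).2
  have hmaps : ∀ n ∈ T, f n ∈ Finset.range (N / L + 1) ×ˢ Finset.range (⌊2 * Δ / δ⌋₊ + 1) := by
    intro n hn
    have h1 : n < N + 1 := Finset.mem_range.mp (Finset.mem_filter.mp hn).1
    have h2 := abs_le.mp (hx n hn)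
    simp only [f, Finset.mem_product, Finset.mem_range, Nat.lt_succ_iff]
    refine ⟨Nat.div_le_div_right (by omega), Nat.floor_le_floor ?_⟩
    gcongr
    linarith
  have hlt : ∀ m ∈ T, ∀ n ∈ T, m < n → f m ≠ f n := by
    intro m hm n hn hmn hf
    obtain ⟨h1, h2⟩ := Prod.mk.inj hf
    have hd : n - m < L := by
      have e1 := Nat.div_add_mod m L
      have e2 := Nat.div_add_mod n L
      have e3 := Nat.mod_lt n hL
      rw [h1] at e1
      omega
    have h3 := h (n - m) (by omega) hd (round (n * α) - round (m * α))
    have hm' := abs_le.mp (hx m hm)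
    have hn' := abs_le.mp (hx n hn)
    have a1 := Nat.floor_le (div_nonneg (by linarith : 0 ≤ x m + Δ) hδ.le)
    have a2 := Nat.lt_floor_add_one ((x m + Δ) / δ)
    have b1 := Nat.floor_le (div_nonneg (by linarith : 0 ≤ x n + Δ) hδ.le)
    have b2 := Nat.lt_floor_add_one ((x n + Δ) / δ)
    rw [h2] at a1 a2
    have h4 : |(x n + Δ) / δ - (x m + Δ) / δ| < 1 := by rw [abs_lt]; constructor <;> linarith
    rw [← sub_div, abs_div, abs_of_pos hδ, div_lt_one hδ] at h4
    refine absurd h3 (not_le.mpr ?_)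
    have h5 : ((n - m : ℕ) : ℝ) * α - ((round (n * α) - round (m * α) : ℤ) : ℝ)
        = x n + Δ - (x m + Δ) := by
      simp only [x]
      push_cast [hmn.le]
      ring
    rwa [h5]
  have hinj : Set.InjOn f T := by
    intro m hm n hn hf
    rcases lt_trichotomy m n with h' | h' | h'
    · exact absurd hf (hlt m hm n hn h')
    · exact h'
    · exact absurd hf.symm (hlt n hn m hm h')
  have hc := Finset.card_le_card_of_injOn f hmaps hinj
  rw [Finset.card_product, Finset.card_range, Finset.card_range] at hc
  calc (T.card : ℝ) ≤ ((N / L + 1 : ℕ) : ℝ) * ((⌊2 * Δ / δ⌋₊ + 1 : ℕ) : ℝ) := by exact_mod_cast hc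
    _ ≤ _ := by
      push_cast
      gcongr
      · exact Nat.cast_div_le
      · exact Nat.floor_le (by positivity)

/-- For 0 < d ≤ q/2 the fraction da/q is at least 1/q from every integer, while dα differs from it
by at most 1/(2q). So the spacing hypothesis holds with distance 1/(2q) and block length ⌊q/2⌋ + 1.
-/
theorem card_filter_near_le {α Δ : ℝ} {q : ℕ} {a : ℤ} (N : ℕ) (hq : 0 < q)
    (hqa : IsCoprime (q : ℤ) a) (hα : |q * α - a| ≤ 1 / q) (hΔ : 0 ≤ Δ) :
    (((Finset.range (N + 1)).filter fun n : ℕ => |n * α - round (n * α)| ≤ Δ).card : ℝ)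
      ≤ (2 * N / q + 1) * (4 * q * Δ + 1) := by
  have hq' : (0 : ℝ) < q := by exact_mod_cast hq
  have hspace : ∀ d : ℕ, 0 < d → d < q / 2 + 1 → ∀ z : ℤ, 1 / (2 * q : ℝ) ≤ |d * α - z| := by
    intro d hd hdq z
    have h1 : (1 : ℝ) ≤ |(d : ℝ) * a - z * q| := by
      have : (d : ℤ) * a - z * q ≠ 0 := by
        intro h0
        have h2 : (q : ℤ) ∣ d * a := ⟨z, by linarith⟩
        have h3 := Int.natCast_dvd_natCast.mp (hqa.dvd_of_dvd_mul_right h2)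
        have := Nat.le_of_dvd hd h3
        omega
      exact_mod_cast Int.one_le_abs this
    have h2 : (d : ℝ) ≤ q / 2 := by
      rw [le_div_iff₀ two_pos]
      exact_mod_cast (by omega : d * 2 ≤ q)
    have h3 : |(d : ℝ) * (q * α - a)| ≤ 1 / 2 := by
      rw [abs_mul, abs_of_nonneg (Nat.cast_nonneg d)]
      calc (d : ℝ) * |q * α - a| ≤ q / 2 * (1 / q) := by gcongr
        _ = 1 / 2 := by field_simp
    have h4 : (q : ℝ) * |d * α - z| = |d * (q * α - a) + (d * a - z * q)| := by
      rw [← abs_of_pos hq', ← abs_mul, abs_of_pos hq']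
      congr 1
      ring
    have h5 : 1 / 2 ≤ (q : ℝ) * |d * α - z| := by
      rw [h4]
      have := abs_sub_abs_le_abs_sub ((d : ℝ) * a - z * q) (-(d * (q * α - a)))
      rw [abs_neg, sub_neg_eq_add, add_comm (_ - _)] at this
      linarith
    rw [div_le_iff₀ (by positivity)]
    linarith
  refine (card_filter_near_le_of_spaced N (Nat.succ_pos _) (by positivity) hΔ hspace).trans ?_
  gcongr ?_ * ?_
  · gcongr ?_ + 1
    rw [div_le_div_iff₀ (by positivity) hq']
    have h6 : (q : ℝ) ≤ 2 * ((q / 2 + 1 : ℕ) : ℝ) := by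
      exact_mod_cast (by omega : q ≤ 2 * (q / 2 + 1))
    calc (N : ℝ) * q ≤ N * (2 * ((q / 2 + 1 : ℕ) : ℝ)) := by gcongr
      _ = _ := by ring
  · apply le_of_eq
    field_simp
    ring

/-- Dirichlet's approximation theorem with a reduced fraction. -/
theorem exists_coprime_approx (ξ : ℝ) {N : ℕ} (hN : 0 < N) :
    ∃ (q : ℕ) (a : ℤ), 0 < q ∧ q ≤ N ∧ IsCoprime (q : ℤ) a ∧ |q * ξ - a| ≤ 1 / (N + 1) := by
  obtain ⟨r, hr, hd⟩ := Real.exists_rat_abs_sub_le_and_den_le ξ hN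
  have hq : (0 : ℝ) < r.den := by exact_mod_cast r.den_pos
  refine ⟨r.den, r.num, r.den_pos, hd, ?_, ?_⟩
  · rw [Int.isCoprime_iff_gcd_eq_one, Int.gcd_comm]
    exact r.reduced
  · have : (r.den : ℝ) * ξ - r.num = r.den * (ξ - r) := by
      have h : (r : ℝ) = r.num / r.den := Rat.cast_def r
      rw [h]
      field_simp
    rw [this, abs_mul, abs_of_pos hq]
    calc (r.den : ℝ) * |ξ - r| ≤ r.den * (1 / ((N + 1) * r.den)) := by gcongr
      _ = _ := by field_simp

/-! ### Weyl's inequality for quadratic sums. -/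

theorem e_add (x y : ℝ) : e (x + y) = e x * e y := by
  rw [e, e, e, ← Complex.exp_add]
  congr 1
  push_cast
  ring

theorem norm_e (x : ℝ) : ‖e x‖ = 1 := by
  rw [e, show (2 * Real.pi * Complex.I * x : ℂ) = ((2 * Real.pi * x : ℝ) : ℂ) * Complex.I by
    push_cast; ring, Complex.norm_exp_ofReal_mul_I]

theorem e_intCast (n : ℤ) : e n = 1 := by
  rw [e, Complex.exp_eq_one_iff]
  exact ⟨n, by push_cast; ring⟩

theorem e_neg (x : ℝ) : e (-x) = (starRingEnd ℂ) (e x) := by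
  rw [e, e, ← Complex.exp_conj]
  congr 1
  simp only [map_mul, Complex.conj_ofReal, Complex.conj_I, map_ofNat]
  push_cast
  ring

theorem e_natCast_mul (n : ℕ) (x : ℝ) : e (n * x) = e x ^ n := by
  rw [e, e, ← Complex.exp_nat_mul]
  congr 1
  push_cast
  ring

theorem four_mul_abs_sub_round_le (γ : ℝ) : 4 * |γ - round γ| ≤ ‖e γ - 1‖ := by
  set t := γ - round γ with ht
  have h1 : e γ = e t := by
    rw [← mul_one (e t), ← e_intCast (round γ), ← e_add, ht, sub_add_cancel]
  have h2 : e t = Complex.exp (Complex.I * ((2 * Real.pi * t : ℝ) : ℂ)) := by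
    rw [e]; congr 1; push_cast; ring
  have h3 : |t| ≤ 1 / 2 := abs_sub_round γ
  rw [h1, h2, Complex.norm_exp_I_mul_ofReal_sub_one, Real.norm_eq_abs, abs_mul,
    abs_of_pos (by norm_num : (0 : ℝ) < 2), show 2 * Real.pi * t / 2 = Real.pi * t by ring]
  have h4 : 2 / Real.pi * (Real.pi * |t|) ≤ Real.sin (Real.pi * |t|) := by
    refine Real.mul_le_sin (by positivity) ?_
    have := Real.pi_pos
    nlinarith
  have h5 : 2 / Real.pi * (Real.pi * |t|) = 2 * |t| := by
    have := Real.pi_pos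
    field_simp
  have h6 : Real.sin (Real.pi * |t|) ≤ |Real.sin (Real.pi * t)| := by
    rcases abs_cases t with ⟨h, _⟩ | ⟨h, _⟩
    · rw [h]; exact le_abs_self _
    · rw [h, mul_neg, Real.sin_neg]; exact neg_le_abs _
  linarith

theorem norm_sum_Ioc_e_mul_le (γ : ℝ) (a b : ℕ) :
    ‖∑ n ∈ Finset.Ioc a b, e (n * γ)‖ * |γ - round γ| ≤ 1 := by
  have h1 : (∑ n ∈ Finset.Ioc a b, e (n * γ)) * (e γ - 1) = e γ ^ (a + 1) * (e γ ^ (b - a) - 1) := by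
    have : ∑ n ∈ Finset.Ioc a b, e (n * γ) = e γ ^ (a + 1) * ∑ i ∈ Finset.range (b - a), e γ ^ i := by
      rw [← Finset.Ico_add_one_add_one_eq_Ioc, Finset.sum_Ico_eq_sum_range, Finset.mul_sum,
        Nat.add_sub_add_right]
      refine Finset.sum_congr rfl fun i _ => ?_
      rw [e_natCast_mul, pow_add]
    rw [this, mul_assoc, geom_sum_mul]
  have h2 : ‖∑ n ∈ Finset.Ioc a b, e (n * γ)‖ * ‖e γ - 1‖ ≤ 2 := by
    rw [← norm_mul, h1, norm_mul, norm_pow, norm_e, one_pow, one_mul]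
    refine (norm_sub_le _ _).trans ?_
    rw [norm_pow, norm_e, one_pow, norm_one]
    norm_num
  have h3 := mul_le_mul_of_nonneg_left (four_mul_abs_sub_round_le γ)
    (norm_nonneg (∑ n ∈ Finset.Ioc a b, e (n * γ)))
  nlinarith [mul_nonneg (norm_nonneg (∑ n ∈ Finset.Ioc a b, e (n * γ))) (abs_nonneg (γ - round γ))]

theorem sq_norm_sum_Ioc_eq (z : ℕ → ℂ) (hz : ∀ n, ‖z n‖ = 1) {a b : ℕ} (hab : a ≤ b) :
    ‖∑ n ∈ Finset.Ioc a b, z n‖ ^ 2 = (b - a : ℕ) +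
      2 * (∑ m ∈ Finset.Ioc a b, ∑ n ∈ Finset.Ioo a m, z m * (starRingEnd ℂ) (z n)).re := by
  induction b, hab using Nat.le_induction with
  | base => simp
  | succ b hab ih =>
    have h1 : Finset.Ioo a (b + 1) = Finset.Ioc a b := by ext; simp
    rw [Finset.sum_Ioc_succ_top hab, Finset.sum_Ioc_succ_top hab, Complex.add_re, h1,
      ← Finset.mul_sum, ← map_sum, add_comm (∑ n ∈ Finset.Ioc a b, z n), Complex.sq_norm,
      Complex.normSq_add, ← Complex.sq_norm, ← Complex.sq_norm, hz, ih, Nat.sub_add_comm hab]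
    push_cast
    ring

/-- The Weyl differencing inequality. -/
theorem sq_norm_sum_Ioc_le (z : ℕ → ℂ) (hz : ∀ n, ‖z n‖ = 1) {a b : ℕ} (hab : a ≤ b) :
    ‖∑ n ∈ Finset.Ioc a b, z n‖ ^ 2 ≤ (b - a : ℕ) + 2 * ∑ h ∈ Finset.Ioc 0 (b - a),
      ‖∑ n ∈ Finset.Ioc a (b - h), z (n + h) * (starRingEnd ℂ) (z n)‖ := by
  have hswap : ∑ m ∈ Finset.Ioc a b, ∑ n ∈ Finset.Ioo a m, z m * (starRingEnd ℂ) (z n)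
      = ∑ h ∈ Finset.Ioc 0 (b - a), ∑ n ∈ Finset.Ioc a (b - h),
        z (n + h) * (starRingEnd ℂ) (z n) := by
    rw [Finset.sum_sigma', Finset.sum_sigma']
    refine Finset.sum_bij' (fun x _ => ⟨x.1 - x.2, x.2⟩) (fun x _ => ⟨x.2 + x.1, x.2⟩) ?_ ?_ ?_ ?_ ?_
    · rintro ⟨m, n⟩ h
      simp only [Finset.mem_sigma, Finset.mem_Ioc, Finset.mem_Ioo] at h ⊢
      omega
    · rintro ⟨m, n⟩ h
      simp only [Finset.mem_sigma, Finset.mem_Ioc, Finset.mem_Ioo] at h ⊢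
      omega
    · rintro ⟨m, n⟩ h
      simp only [Finset.mem_sigma, Finset.mem_Ioc, Finset.mem_Ioo] at h
      simp only [Sigma.mk.injEq, heq_eq_eq, and_true]
      omega
    · rintro ⟨m, n⟩ h
      simp
    · rintro ⟨m, n⟩ h
      simp only [Finset.mem_sigma, Finset.mem_Ioc, Finset.mem_Ioo] at h
      simp only
      rw [Nat.add_sub_cancel' (by omega)]
  rw [sq_norm_sum_Ioc_eq z hz hab, hswap]
  gcongr
  exact (Complex.re_le_norm _).trans (norm_sum_le _ _)

/-- If t lies between 2^{-j-1} and 2^{-j}, then g ≤ 1/t ≤ 2^{j+1}; if t ≤ 2^{-J}, the trivial bound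
serves. Summing over many t then becomes counting the t below each dyadic threshold. -/
theorem le_sum_two_pow_of_mul_le {g t : ℝ} {J : ℕ} (hg : g ≤ 2 ^ J) (ht : t ≤ 1)
    (hgt : g * t ≤ 1) :
    g ≤ ∑ j ∈ Finset.range (J + 1), if t ≤ (1 / 2) ^ j then (2 : ℝ) ^ (j + 1) else 0 := by
  have hnn : ∀ j ∈ Finset.range (J + 1), (0 : ℝ) ≤ if t ≤ (1 / 2) ^ j then (2 : ℝ) ^ (j + 1) else 0 := by
    intro j _
    split_ifs <;> positivity
  suffices h : ∃ j ∈ Finset.range (J + 1), t ≤ (1 / 2) ^ j ∧ g ≤ 2 ^ (j + 1) by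
    obtain ⟨j, hj, h1, h2⟩ := h
    refine le_trans ?_ (Finset.single_le_sum hnn hj)
    rwa [if_pos h1]
  by_cases hJ : t ≤ (1 / 2) ^ J
  · refine ⟨J, by simp, hJ, hg.trans ?_⟩
    rw [pow_succ]
    linarith [pow_pos (two_pos : (0 : ℝ) < 2) J]
  · have hex : ∃ k, ¬ t ≤ (1 / 2 : ℝ) ^ k := ⟨J, hJ⟩
    obtain ⟨k, hk, hkmin⟩ : ∃ k, ¬ t ≤ (1 / 2 : ℝ) ^ k ∧ ∀ i < k, t ≤ (1 / 2 : ℝ) ^ i := by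
      classical
      exact ⟨Nat.find hex, Nat.find_spec hex, fun i hi => not_not.mp (Nat.find_min hex hi)⟩
    have hk0 : k ≠ 0 := by rintro rfl; simp at hk; linarith
    obtain ⟨j, rfl⟩ := Nat.exists_eq_succ_of_ne_zero hk0
    have hkJ : j + 1 ≤ J := by
      by_contra hlt
      exact hJ (hkmin J (by omega))
    refine ⟨j, by simp; omega, hkmin j (by omega), ?_⟩
    rw [not_le] at hk
    have hpos : 0 < t := lt_trans (by positivity) hk
    have h1 : (1 / 2 : ℝ) ^ (j + 1) * 2 ^ (j + 1) = 1 := by rw [← mul_pow]; norm_num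
    by_contra hcon
    rw [not_le] at hcon
    have : (1 / 2 : ℝ) ^ (j + 1) * 2 ^ (j + 1) < t * g :=
      mul_lt_mul'' hk hcon (by positivity) (by positivity)
    linarith

/-- Weyl's inequality for quadratic exponential sums over an interval of length `L`. -/
theorem sq_norm_sum_e_sq_le {β : ℝ} {q : ℕ} {c : ℤ} (hq : 0 < q) (hqc : IsCoprime (q : ℤ) c)
    (hβ : |q * β - c| ≤ 1 / q) {a L J : ℕ} (hL : 1 ≤ L) (hJ : (L : ℝ) ≤ 2 ^ J)
    (hJ' : (2 : ℝ) ^ J ≤ 2 * L) :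
    ‖∑ m ∈ Finset.Ioc a (a + L), e (β * (m : ℝ) ^ 2)‖ ^ 2
      ≤ 81 * (J + 1) * ((L : ℝ) ^ 2 / q + L + q) := by
  have hq' : (0 : ℝ) < q := by exact_mod_cast hq
  have hL' : (1 : ℝ) ≤ L := by exact_mod_cast hL
  have h1 := sq_norm_sum_Ioc_le (fun m : ℕ => e (β * (m : ℝ) ^ 2)) (fun _ => norm_e _)
    (Nat.le_add_right a L)
  rw [Nat.add_sub_cancel_left] at h1
  have h2 : ∀ h ∈ Finset.Ioc 0 L, ‖∑ n ∈ Finset.Ioc a (a + L - h),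
      e (β * ((n + h : ℕ) : ℝ) ^ 2) * (starRingEnd ℂ) (e (β * (n : ℝ) ^ 2))‖
      ≤ ∑ j ∈ Finset.range (J + 1),
        if |((2 * h : ℕ) : ℝ) * β - round (((2 * h : ℕ) : ℝ) * β)| ≤ (1 / 2) ^ j
          then (2 : ℝ) ^ (j + 1) else 0 := by
    intro h hh
    -- Differencing leaves a phase linear in n, of frequency 2hβ, hence a geometric series.
    have h3 : ∑ n ∈ Finset.Ioc a (a + L - h),
        e (β * ((n + h : ℕ) : ℝ) ^ 2) * (starRingEnd ℂ) (e (β * (n : ℝ) ^ 2))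
        = e (β * (h : ℝ) ^ 2) * ∑ n ∈ Finset.Ioc a (a + L - h),
          e (n * (((2 * h : ℕ) : ℝ) * β)) := by
      rw [Finset.mul_sum]
      refine Finset.sum_congr rfl fun n _ => ?_
      rw [← e_neg, ← e_add, ← e_add]
      congr 1
      push_cast
      ring
    rw [h3, norm_mul, norm_e, one_mul]
    refine le_sum_two_pow_of_mul_le ?_ ?_ (norm_sum_Ioc_e_mul_le _ _ _)
    · refine (norm_sum_le _ _).trans ?_
      simp only [norm_e, Finset.sum_const, Nat.card_Ioc, nsmul_eq_mul, mul_one]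
      refine le_trans ?_ hJ
      exact_mod_cast (by omega : a + L - h - a ≤ L)
    · exact (abs_sub_round _).trans (by norm_num)
  have h4 : ∀ j ∈ Finset.range (J + 1), (∑ h ∈ Finset.Ioc 0 L,
      if |((2 * h : ℕ) : ℝ) * β - round (((2 * h : ℕ) : ℝ) * β)| ≤ (1 / 2) ^ j
          then (2 : ℝ) ^ (j + 1) else 0) ≤ (4 * L / q + 1) * (8 * q + 2 * 2 ^ j) := by
    intro j _
    rw [← Finset.sum_filter, Finset.sum_const, nsmul_eq_mul]
    have h5 : (((Finset.Ioc 0 L).filter fun h : ℕ =>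
        |((2 * h : ℕ) : ℝ) * β - round (((2 * h : ℕ) : ℝ) * β)| ≤ (1 / 2) ^ j).card : ℝ)
        ≤ (2 * (2 * L : ℕ) / q + 1) * (4 * q * (1 / 2) ^ j + 1) := by
      refine le_trans ?_ (card_filter_near_le (2 * L) hq hqc hβ (by positivity))
      norm_cast
      refine Finset.card_le_card_of_injOn (fun h => 2 * h) ?_ ?_
      · intro h hh
        simp only [Finset.coe_filter, Set.mem_ofPred_eq, Finset.mem_Ioc, Finset.mem_range] at hh ⊢
        exact ⟨by omega, hh.2⟩
      · intro x _ y _ hxy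
        simp only at hxy
        omega
    have h6 : (1 / 2 : ℝ) ^ j * 2 ^ j = 1 := by rw [← mul_pow]; norm_num
    calc _ ≤ (2 * (2 * L : ℕ) / q + 1) * (4 * q * (1 / 2 : ℝ) ^ j + 1) * (2 : ℝ) ^ (j + 1) := by
          gcongr
      _ = (4 * L / q + 1) * (8 * q * ((1 / 2 : ℝ) ^ j * 2 ^ j) + 2 * 2 ^ j) := by
          push_cast
          ring
      _ = _ := by rw [h6, mul_one]
  have h7 : ∑ h ∈ Finset.Ioc 0 L, ‖∑ n ∈ Finset.Ioc a (a + L - h),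
      e (β * ((n + h : ℕ) : ℝ) ^ 2) * (starRingEnd ℂ) (e (β * (n : ℝ) ^ 2))‖
      ≤ (4 * L / q + 1) * (8 * q * (J + 1) + 8 * L) := by
    refine (Finset.sum_le_sum h2).trans ?_
    rw [Finset.sum_comm]
    refine (Finset.sum_le_sum h4).trans ?_
    rw [← Finset.mul_sum]
    gcongr
    rw [Finset.sum_add_distrib, Finset.sum_const, Finset.card_range, nsmul_eq_mul, ← Finset.mul_sum,
      geom_sum_eq (by norm_num)]
    push_cast
    rw [pow_succ]
    linarith
  have hJ1 : (0 : ℝ) ≤ J := Nat.cast_nonneg J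
  have h8 : (4 * L / q + 1 : ℝ) * (8 * q * (J + 1) + 8 * L)
      ≤ (4 * L / q + 1) * ((J + 1) * (8 * q + 8 * L)) := by
    gcongr
    nlinarith
  have h9 : (4 * L / q + 1 : ℝ) * ((J + 1) * (8 * q + 8 * L))
      = (J + 1) * (40 * L + 32 * (L ^ 2 / q) + 8 * q) := by
    field_simp
    ring
  have h10 : (0 : ℝ) ≤ L ^ 2 / q := by positivity
  calc _ ≤ (L : ℝ) + 2 * ((J + 1) * (40 * L + 32 * (L ^ 2 / q) + 8 * q)) := by
        rw [← h9]
        exact h1.trans (by linarith)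
    _ ≤ (J + 1) * L + 2 * ((J + 1) * (40 * L + 32 * (L ^ 2 / q) + 8 * q)) := by nlinarith
    _ = (J + 1) * (81 * L + 64 * (L ^ 2 / q) + 16 * q) := by ring
    _ ≤ (J + 1) * (81 * (L ^ 2 / q + L + q)) := by
        gcongr
        linarith
    _ = _ := by ring

/-! ### Weyl's inequality in terms of `kappa`. -/

/-- `kappa β Y` is the infimum of `q + Y²|qβ - b|` over integers `q ≥ 1` and `b`. -/
noncomputable def kappa (β Y : ℝ) : ℝ :=
  ⨅ p : ℕ × ℤ, ((p.1 + 1 : ℕ) : ℝ) + Y ^ 2 * |((p.1 + 1 : ℕ) : ℝ) * β - p.2|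

theorem kappa_le (β Y : ℝ) {q : ℕ} (hq : 0 < q) (b : ℤ) :
    kappa β Y ≤ q + Y ^ 2 * |q * β - b| := by
  have hb : BddBelow (Set.range fun p : ℕ × ℤ =>
      ((p.1 + 1 : ℕ) : ℝ) + Y ^ 2 * |((p.1 + 1 : ℕ) : ℝ) * β - p.2|) := by
    refine ⟨0, ?_⟩
    rintro _ ⟨p, rfl⟩
    positivity
  have := ciInf_le hb (q - 1, b)
  simp only [Nat.sub_add_cancel hq] at this
  exact this

theorem le_kappa {β Y K : ℝ}
    (h : ∀ q : ℕ, 0 < q → ∀ b : ℤ, K ≤ q + Y ^ 2 * |q * β - b|) : K ≤ kappa β Y :=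
  le_ciInf fun p => h (p.1 + 1) (Nat.succ_pos _) p.2

theorem exists_of_kappa_lt {β Y K : ℝ} (h : kappa β Y < K) :
    ∃ q : ℕ, 0 < q ∧ ∃ b : ℤ, q + Y ^ 2 * |q * β - b| < K := by
  by_contra! hcon
  exact absurd (le_kappa hcon) (not_le.mpr h)

theorem one_le_kappa (β Y : ℝ) : 1 ≤ kappa β Y := by
  refine le_kappa fun q hq b => ?_
  have : (1 : ℝ) ≤ q := by exact_mod_cast hq
  have : 0 ≤ Y ^ 2 * |q * β - b| := by positivity
  linarith

/-- Take a Dirichlet fraction c/q with q ≤ L. If q ≥ κ/2, Weyl's inequality with this q suffices.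
Otherwise η = |qβ - c| is at least κ/(2M²), and a second Dirichlet fraction at level about 2/η has
denominator of order 1/η, which lies between L and 2M²/κ up to constants. -/
theorem sq_norm_sum_e_sq_le_kappa (β : ℝ) {M : ℝ} {a L J : ℕ} (hL : 1 ≤ L)
    (hJ : (L : ℝ) ≤ 2 ^ J) (hJ' : (2 : ℝ) ^ J ≤ 2 * L) (hLM : (L : ℝ) ≤ 3 * M) :
    ‖∑ m ∈ Finset.Ioc a (a + L), e (β * (m : ℝ) ^ 2)‖ ^ 2
      ≤ 1458 * (J + 1) * (L + M ^ 2 / kappa β M) := by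
  have hL' : (1 : ℝ) ≤ L := by exact_mod_cast hL
  have hκ := one_le_kappa β M
  have hκ0 : 0 < kappa β M := by linarith
  have hMκ : 0 ≤ M ^ 2 / kappa β M := by positivity
  obtain ⟨q, c, hq, hqL, hqc, happ⟩ := exists_coprime_approx β hL
  have hq' : (0 : ℝ) < q := by exact_mod_cast hq
  have hqL' : (q : ℝ) ≤ L := by exact_mod_cast hqL
  have hle := kappa_le β M hq c
  rcases le_or_gt (kappa β M) (2 * q) with hcase | hcase
  · have h1 : |q * β - c| ≤ 1 / q := happ.trans (one_div_le_one_div_of_le hq' (by linarith))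
    refine (sq_norm_sum_e_sq_le hq hqc h1 hL hJ hJ').trans ?_
    have h2 : (L : ℝ) ^ 2 / q ≤ 18 * (M ^ 2 / kappa β M) := by
      have : (L : ℝ) ^ 2 ≤ (3 * M) ^ 2 := by gcongr
      rw [← mul_div_assoc, div_le_div_iff₀ hq' hκ0]
      calc (L : ℝ) ^ 2 * kappa β M ≤ (3 * M) ^ 2 * (2 * q) := by gcongr
        _ = _ := by ring
    rw [show (1458 : ℝ) * (J + 1) = 81 * (J + 1) * 18 by ring, mul_assoc (81 * ((J : ℝ) + 1))]
    gcongr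
    linarith
  · set η := |q * β - c| with hη
    have hη1 : kappa β M / 2 ≤ M ^ 2 * η := by linarith
    have hη0 : 0 < η := by
      by_contra hcon
      have : η = 0 := le_antisymm (not_lt.mp hcon) (abs_nonneg _)
      rw [this] at hη1
      linarith
    set t := 1 / η with ht
    have ht0 : 0 < t := by positivity
    have htη : t * η = 1 := by rw [ht]; field_simp
    have hLt : (L : ℝ) + 1 ≤ t := by
      rw [ht, le_div_iff₀ hη0]
      rw [le_div_iff₀ (by linarith)] at happ
      linarith
    have htκ : t ≤ 2 * (M ^ 2 / kappa β M) := by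
      rw [ht, ← mul_div_assoc, div_le_div_iff₀ hη0 hκ0]
      linarith
    have hN : 0 < ⌈2 * t⌉₊ := Nat.ceil_pos.mpr (by positivity)
    obtain ⟨q', c', hq0, hqN, hqc', happ'⟩ := exists_coprime_approx β hN
    have hq0' : (0 : ℝ) < q' := by exact_mod_cast hq0
    have hN1 := Nat.le_ceil (2 * t)
    have hN2 := Nat.ceil_lt_add_one (by positivity : 0 ≤ 2 * t)
    have hqN' : (q' : ℝ) ≤ ⌈2 * t⌉₊ := by exact_mod_cast hqN
    have happ2 : |q' * β - c'| ≤ η / 2 := by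
      refine happ'.trans ?_
      rw [div_le_div_iff₀ (by linarith) two_pos]
      nlinarith
    -- Both fractions are reduced, so equality would identify them and give η ≤ η/2. Being distinct,
    -- they satisfy 1 ≤ q'η + qη/2 with qη ≤ 1, which forces q' ≥ 1/(2η).
    have hne : (c : ℤ) * q' - c' * q ≠ 0 := by
      intro h0
      have d1 : (q : ℤ) ∣ q' := hqc.dvd_of_dvd_mul_left ⟨c', by linarith⟩
      have d2 : (q' : ℤ) ∣ q := hqc'.dvd_of_dvd_mul_left ⟨c, by linarith⟩
      have hqq : q = q' := Nat.dvd_antisymm (Int.natCast_dvd_natCast.mp d1)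
        (Int.natCast_dvd_natCast.mp d2)
      subst hqq
      have hcc : c = c' := by
        have hqz : (q : ℤ) ≠ 0 := by exact_mod_cast hq.ne'
        exact mul_right_cancel₀ hqz (by linarith)
      subst hcc
      rw [← hη] at happ2
      linarith
    have h1 : (1 : ℝ) ≤ |(c : ℝ) * q' - c' * q| := by exact_mod_cast Int.one_le_abs hne
    have h2 : |(c : ℝ) * q' - c' * q| ≤ q' * η + q * (η / 2) := by
      have : (c : ℝ) * q' - c' * q = q * (q' * β - c') - q' * (q * β - c) := by ring
      rw [this]
      refine (abs_sub _ _).trans ?_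
      rw [abs_mul, abs_mul, abs_of_pos hq', abs_of_pos hq0', ← hη]
      have := mul_le_mul_of_nonneg_left happ2 hq'.le
      linarith
    have h3 : (q : ℝ) * η ≤ 1 := by
      rw [← htη]
      gcongr
      linarith
    have h4 : t / 2 ≤ q' := by
      have : 1 / 2 ≤ (q' : ℝ) * η := by linarith
      rw [ht, div_div, div_le_iff₀ (by positivity)]
      linarith
    have h5 : |q' * β - c'| ≤ 1 / q' :=
      happ'.trans (one_div_le_one_div_of_le hq0' (by linarith))
    refine (sq_norm_sum_e_sq_le hq0 hqc' h5 hL hJ hJ').trans ?_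
    have h6 : (L : ℝ) ^ 2 / q' ≤ 2 * L := by
      rw [div_le_iff₀ hq0']
      nlinarith
    rw [show (1458 : ℝ) * (J + 1) = 81 * (J + 1) * 18 by ring, mul_assoc (81 * ((J : ℝ) + 1))]
    gcongr
    linarith

/-- Capping κ at W ≤ DM absorbs the diagonal term: M ≤ D · M²/min(κ, W). -/
theorem norm_sum_dyadic_e_sq_le {δ D : ℝ} (hδ : 0 < δ) (hD : 0 ≤ D) :
    ∃ C : ℝ, 0 ≤ C ∧ ∀ X β M W : ℝ, 0 < M → M ≤ X → 0 < W → W ≤ D * M →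
      ‖∑ m ∈ dyadic M, e (β * (m : ℝ) ^ 2)‖
        ≤ C * X ^ δ * M * (1 / √(min (kappa β M) W)) := by
  obtain ⟨c, hc1, hc⟩ := exists_add_one_le_mul_two_pow_rpow (by positivity : 0 < 2 * δ)
  refine ⟨√(1458 * (c * 6 ^ (2 * δ)) * (3 * D + 1)), by positivity, fun X β M W hM hMX hW hWD => ?_⟩
  have hX : 0 < X := by linarith
  have hκ := one_le_kappa β M
  have hmin : 0 < min (kappa β M) W := lt_min (by linarith) hW
  rcases Nat.lt_or_ge ⌊M⌋₊ ⌊2 * M⌋₊ with hlt | hge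
  swap
  · rw [dyadic, Finset.Ioc_eq_empty (by omega), Finset.sum_empty, norm_zero]
    positivity
  obtain ⟨L, hLeq⟩ := Nat.exists_eq_add_of_le hlt.le
  have hL : 1 ≤ L := by omega
  have hL' : (1 : ℝ) ≤ L := by exact_mod_cast hL
  have hM1 : (1 : ℝ) ≤ 2 * M := by
    have h1 : (⌊2 * M⌋₊ : ℝ) ≤ 2 * M := Nat.floor_le (by positivity)
    have h2 : (1 : ℝ) ≤ ⌊2 * M⌋₊ := by exact_mod_cast (by omega : 1 ≤ ⌊2 * M⌋₊)
    linarith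
  have hLM : (L : ℝ) ≤ 3 * M := by
    have h1 : (⌊2 * M⌋₊ : ℝ) ≤ 2 * M := Nat.floor_le (by positivity)
    have h2 := Nat.lt_floor_add_one M
    rw [hLeq] at h1
    push_cast at h1
    linarith
  obtain ⟨j, hj1, hj2⟩ := exists_nat_pow_near hL' (one_lt_two : (1 : ℝ) < 2)
  have hJ' : (2 : ℝ) ^ (j + 1) ≤ 2 * L := by rw [pow_succ]; linarith
  have h1 := sq_norm_sum_e_sq_le_kappa β (a := ⌊M⌋₊) hL hj2.le hJ' hLM
  rw [dyadic, hLeq]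
  have h2 : ((j + 1 : ℕ) : ℝ) + 1 ≤ c * 6 ^ (2 * δ) * X ^ (2 * δ) := by
    refine (hc (j + 1)).trans ?_
    rw [mul_assoc, ← Real.mul_rpow (by norm_num) hX.le]
    gcongr
    linarith
  have h3 : (L : ℝ) + M ^ 2 / kappa β M ≤ (3 * D + 1) * (M ^ 2 / min (kappa β M) W) := by
    have h4 : M ^ 2 / kappa β M ≤ M ^ 2 / min (kappa β M) W := by
      gcongr
      exact min_le_left _ _
    have h5 : M ≤ D * (M ^ 2 / min (kappa β M) W) := by
      have : min (kappa β M) W ≤ D * M := (min_le_right _ _).trans hWD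
      rw [← mul_div_assoc, le_div_iff₀ hmin]
      nlinarith
    linarith
  refine abs_le_of_sq_le_sq' ?_ (by positivity) |>.2
  refine h1.trans ?_
  have h6 : (√(1458 * (c * 6 ^ (2 * δ)) * (3 * D + 1)) * X ^ δ * M * (1 / √(min (kappa β M) W))) ^ 2
      = 1458 * (c * 6 ^ (2 * δ) * X ^ (2 * δ)) * ((3 * D + 1) * (M ^ 2 / min (kappa β M) W)) := by
    rw [mul_pow, mul_pow, mul_pow, div_pow, Real.sq_sqrt (by positivity), Real.sq_sqrt hmin.le,
      ← Real.rpow_natCast (X ^ δ), ← Real.rpow_mul hX.le, mul_comm δ]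
    push_cast
    ring
  rw [h6]
  gcongr

/-! ### Averaging over s. -/

theorem sum_dyadic_gcd_le {S : ℝ} (hS : 0 < S) {q : ℕ} (hq : 0 < q) :
    ∑ s ∈ dyadic S, (q.gcd s : ℝ) ≤ 2 * S * q.divisors.card := by
  have h1 : ∑ s ∈ dyadic S, q.gcd s ≤ q.divisors.card * ⌊2 * S⌋₊ := by
    calc ∑ s ∈ dyadic S, q.gcd s
        ≤ ∑ s ∈ Finset.Ioc 0 ⌊2 * S⌋₊, ∑ d ∈ q.divisors, if d ∣ s then d else 0 := by
          refine (Finset.sum_le_sum_of_subset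
            (Finset.Ioc_subset_Ioc_left (Nat.zero_le _))).trans ?_
          refine Finset.sum_le_sum fun s _ => ?_
          have := Finset.single_le_sum (f := fun d => if d ∣ s then d else 0)
            (fun _ _ => Nat.zero_le _)
            (Nat.mem_divisors.mpr ⟨Nat.gcd_dvd_left q s, hq.ne'⟩)
          simpa [Nat.gcd_dvd_right q s] using this
      _ = ∑ d ∈ q.divisors, (⌊2 * S⌋₊ / d) * d := by
          rw [Finset.sum_comm]
          refine Finset.sum_congr rfl fun d _ => ?_
          rw [← Finset.sum_filter, Finset.sum_const, Nat.Ioc_filter_dvd_card_eq_div, smul_eq_mul]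
      _ ≤ ∑ d ∈ q.divisors, ⌊2 * S⌋₊ := Finset.sum_le_sum fun d _ => Nat.div_mul_le_self _ _
      _ = _ := by rw [Finset.sum_const, smul_eq_mul]
  calc ∑ s ∈ dyadic S, (q.gcd s : ℝ) ≤ q.divisors.card * (⌊2 * S⌋₊ : ℝ) := by exact_mod_cast h1
    _ ≤ q.divisors.card * (2 * S) := by
        gcongr
        exact Nat.floor_le (by positivity)
    _ = _ := by ring

theorem pos_of_mem_dyadic {S : ℝ} {s : ℕ} (hs : s ∈ dyadic S) : 0 < s :=
  (Nat.zero_le _).trans_lt (Finset.mem_Ioc.mp hs).1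

/-- Approximations to `s²β` come from approximations to `β`, with a loss of `gcd(q, s)²`. -/
theorem min_kappa_le_gcd_sq_mul {β Y S W : ℝ} (hY : 0 < Y) (hS : 0 < S) (hW0 : 0 < W)
    (h : S ^ 2 * W ≤ Y / 10) {q₁ N : ℕ} {b₁ : ℤ} (hq₁ : 0 < q₁) (hqN : q₁ ≤ N)
    (hN : 8 * S ^ 2 * W ≤ N) (hN' : N ≤ 8 * S ^ 2 * W + 1) (hcop : IsCoprime (q₁ : ℤ) b₁)
    (happ : |q₁ * β - b₁| ≤ 1 / (N + 1)) {s : ℕ} (hs : s ∈ dyadic S) :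
    min (kappa β Y) W ≤ (q₁.gcd s : ℝ) ^ 2 * min (kappa ((s : ℝ) ^ 2 * β) (Y / s)) W := by
  have hs0 := pos_of_mem_dyadic hs
  have hs0' : (0 : ℝ) < s := by exact_mod_cast hs0
  have hs1 : (1 : ℝ) ≤ s := by exact_mod_cast hs0
  have hs2 : (s : ℝ) ≤ 2 * S := ((mem_dyadic hS.le s).mp hs).2
  have hq' : (0 : ℝ) < q₁ := by exact_mod_cast hq₁
  have hqN' : (q₁ : ℝ) ≤ N := by exact_mod_cast hqN
  have hg : (1 : ℝ) ≤ q₁.gcd s := by exact_mod_cast Nat.gcd_pos_of_pos_left s hq₁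
  have hκ := one_le_kappa β Y
  rw [← div_le_iff₀' (by positivity)]
  rcases le_or_gt W 1 with hW1 | hW1
  · have h1 := one_le_kappa ((s : ℝ) ^ 2 * β) (Y / s)
    rw [min_eq_right (by linarith), min_eq_right (by linarith)]
    exact div_le_self hW0.le (one_le_pow₀ hg)
  have hmin : 0 < min (kappa β Y) W := lt_min (by linarith) hW0
  refine le_min ?_ ((div_le_self hmin.le (one_le_pow₀ hg)).trans (min_le_right _ _))
  refine le_kappa fun q hq b => ?_
  rcases le_or_gt W (q + (Y / s) ^ 2 * |q * ((s : ℝ) ^ 2 * β) - b|) with hle | hlt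
  · exact (div_le_self hmin.le (one_le_pow₀ hg)).trans ((min_le_right _ _).trans hle)
  have hq0' : (0 : ℝ) < q := by exact_mod_cast hq
  have hqW : (q : ℝ) < W := by
    have : 0 ≤ (Y / s) ^ 2 * |q * ((s : ℝ) ^ 2 * β) - b| := by positivity
    linarith
  have hsS : (s : ℝ) ^ 2 ≤ 4 * S ^ 2 := by nlinarith
  have hbW : |q * ((s : ℝ) ^ 2 * β) - b| ≤ 4 * S ^ 2 * W / Y ^ 2 := by
    have h1 : (Y / s) ^ 2 * |q * ((s : ℝ) ^ 2 * β) - b| ≤ W := by linarith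
    rw [div_pow, div_mul_eq_mul_div, div_le_iff₀ (by positivity)] at h1
    rw [le_div_iff₀ (by positivity)]
    nlinarith
  -- The two sides are integers whose difference is less than 1: one error is at most 1/2 because N
  -- ≥ 8S²W, the other at most 48(S²W/Y)² ≤ 0.48, which is where the constant 1/10 enters.
  have heq : b₁ * (s : ℤ) ^ 2 * q = b * q₁ := by
    by_contra hne
    have h1 : (1 : ℝ) ≤ |(b₁ : ℝ) * (s : ℝ) ^ 2 * q - b * q₁| := by
      exact_mod_cast Int.one_le_abs (sub_ne_zero.mpr hne)
    have h2 : |(b₁ : ℝ) * (s : ℝ) ^ 2 * q - b * q₁|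
        ≤ q₁ * |q * ((s : ℝ) ^ 2 * β) - b| + s ^ 2 * q * |q₁ * β - b₁| := by
      have : (b₁ : ℝ) * (s : ℝ) ^ 2 * q - b * q₁
          = q₁ * (q * ((s : ℝ) ^ 2 * β) - b) - s ^ 2 * q * (q₁ * β - b₁) := by ring
      rw [this]
      refine (abs_sub _ _).trans ?_
      rw [abs_mul, abs_mul, abs_of_pos hq', abs_of_pos (by positivity : (0 : ℝ) < s ^ 2 * q)]
    have hSW : 0 < S ^ 2 * W := by positivity
    have h3 : (s : ℝ) ^ 2 * q * |q₁ * β - b₁| ≤ 1 / 2 := by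
      calc (s : ℝ) ^ 2 * q * |q₁ * β - b₁| ≤ 4 * S ^ 2 * W * (1 / (N + 1)) := by gcongr
        _ ≤ 1 / 2 := by
          rw [mul_one_div, div_le_div_iff₀ (by positivity) two_pos]
          linarith
    have h4 : (N : ℝ) ≤ 12 * (S ^ 2 * W) := by nlinarith
    have h5 : (q₁ : ℝ) * |q * ((s : ℝ) ^ 2 * β) - b| < 1 / 2 := by
      calc (q₁ : ℝ) * |q * ((s : ℝ) ^ 2 * β) - b|
          ≤ 12 * (S ^ 2 * W) * (4 * S ^ 2 * W / Y ^ 2) := by gcongr; linarith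
        _ = 48 * ((S ^ 2 * W) / Y) ^ 2 := by field_simp; ring
        _ ≤ 48 * (1 / 10) ^ 2 := by
          have : S ^ 2 * W / Y ≤ 1 / 10 := by
            rw [div_le_iff₀ hY]
            linarith
          gcongr
        _ < 1 / 2 := by norm_num
    linarith
  -- Since b₁ is coprime to q₁, the identity makes q₁ divide s²q. So q₁ exceeds q by at most a
  -- factor gcd(q₁, s)².
  have hdvd : q₁ ∣ q₁.gcd (s ^ 2) * q := by
    have h1 : (q₁ : ℤ) ∣ (s : ℤ) ^ 2 * q :=
      hcop.dvd_of_dvd_mul_left ⟨b, by rw [← mul_assoc, heq, mul_comm]⟩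
    have h2 : q₁ ∣ s ^ 2 * q := by exact_mod_cast h1
    rw [← Nat.gcd_mul_right]
    exact Nat.dvd_gcd (Dvd.intro _ rfl) h2
  have hG0 : 0 < q₁.gcd (s ^ 2) := Nat.gcd_pos_of_pos_left _ hq₁
  have hGq : (q₁ : ℝ) ≤ q₁.gcd (s ^ 2) * q := by
    exact_mod_cast Nat.le_of_dvd (Nat.mul_pos hG0 hq) hdvd
  have hGg : (q₁.gcd (s ^ 2) : ℝ) ≤ (q₁.gcd s : ℝ) ^ 2 := by
    have h1 : q₁.gcd (s ^ 2) ∣ q₁.gcd s * q₁.gcd s := by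
      rw [pow_two]
      exact Nat.gcd_mul_right_dvd_mul_gcd q₁ s s
    have h2 := Nat.le_of_dvd (Nat.mul_pos (Nat.gcd_pos_of_pos_left s hq₁)
      (Nat.gcd_pos_of_pos_left s hq₁)) h1
    rw [← pow_two] at h2
    exact_mod_cast h2
  have hqg : (q₁ : ℝ) ≤ (q₁.gcd s : ℝ) ^ 2 * q := hGq.trans (by gcongr)
  have hdist : (q₁ : ℝ) * |q * ((s : ℝ) ^ 2 * β) - b| = q * s ^ 2 * |q₁ * β - b₁| := by
    have heq' : (b₁ : ℝ) * (s : ℝ) ^ 2 * q = b * q₁ := by exact_mod_cast heq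
    have hqs : (0 : ℝ) < q * s ^ 2 := by positivity
    have h1 : (q₁ : ℝ) * (q * ((s : ℝ) ^ 2 * β) - b) = q * s ^ 2 * (q₁ * β - b₁) := by
      linear_combination heq'
    have h2 := congrArg abs h1
    rwa [abs_mul, abs_mul, abs_of_pos hq', abs_of_pos hqs] at h2
  rw [div_le_iff₀' (by positivity)]
  refine (min_le_left _ _).trans ((kappa_le β Y hq₁ b₁).trans ?_)
  rw [mul_add]
  refine add_le_add hqg ?_
  have h6 : (Y / s) ^ 2 * |q * ((s : ℝ) ^ 2 * β) - b| = Y ^ 2 * (q / q₁ * |q₁ * β - b₁|) := by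
    have : |q * ((s : ℝ) ^ 2 * β) - b| = q * s ^ 2 * |q₁ * β - b₁| / q₁ := by
      rw [eq_div_iff hq'.ne', ← hdist, mul_comm]
    rw [this]
    field_simp
  rw [h6]
  have h7 : 1 ≤ (q₁.gcd s : ℝ) ^ 2 * (q / q₁) := by
    rw [← mul_div_assoc, le_div_iff₀ hq']
    linarith
  calc Y ^ 2 * |q₁ * β - b₁| = 1 * (Y ^ 2 * |q₁ * β - b₁|) := (one_mul _).symm
    _ ≤ (q₁.gcd s : ℝ) ^ 2 * (q / q₁) * (Y ^ 2 * |q₁ * β - b₁|) := by gcongr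
    _ = _ := by ring

theorem sum_one_div_sqrt_min_kappa_le {β Y S W : ℝ} (hY : 0 < Y) (hS : 0 < S) (hW : 0 < W)
    (h : S ^ 2 * W ≤ Y / 10) :
    ∃ q : ℕ, (q : ℝ) ≤ 8 * S ^ 2 * W + 1 ∧
      ∑ s ∈ dyadic S, 1 / √(min (kappa ((s : ℝ) ^ 2 * β) (Y / s)) W)
        ≤ 2 * S * q.divisors.card * (1 / √(min (kappa β Y) W)) := by
  have hN : 0 < ⌈8 * S ^ 2 * W⌉₊ := Nat.ceil_pos.mpr (by positivity)
  obtain ⟨q, b, hq, hqN, hcop, happ⟩ := exists_coprime_approx β hN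
  have hN1 := Nat.le_ceil (8 * S ^ 2 * W)
  have hN2 := (Nat.ceil_lt_add_one (by positivity : 0 ≤ 8 * S ^ 2 * W)).le
  refine ⟨q, le_trans (by exact_mod_cast hqN) hN2, ?_⟩
  have hmin : ∀ β Y, 0 < min (kappa β Y) W := fun β Y =>
    lt_min (by linarith [one_le_kappa β Y]) hW
  calc ∑ s ∈ dyadic S, 1 / √(min (kappa ((s : ℝ) ^ 2 * β) (Y / s)) W)
      ≤ ∑ s ∈ dyadic S, (q.gcd s : ℝ) * (1 / √(min (kappa β Y) W)) := by
        refine Finset.sum_le_sum fun s hs => ?_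
        have h1 := min_kappa_le_gcd_sq_mul hY hS hW h hq hqN hN1 hN2 hcop happ hs
        have h2 := Real.sqrt_le_sqrt h1
        rw [Real.sqrt_mul (by positivity), Real.sqrt_sq (by positivity)] at h2
        rw [mul_one_div, div_le_div_iff₀ (Real.sqrt_pos.mpr (hmin _ _))
          (Real.sqrt_pos.mpr (hmin _ _)), one_mul]
        exact h2
    _ = (∑ s ∈ dyadic S, (q.gcd s : ℝ)) * (1 / √(min (kappa β Y) W)) := by rw [Finset.sum_mul]
    _ ≤ _ := by
        gcongr
        exact sum_dyadic_gcd_le hS hq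

/-! ### Counting r with small `kappa`, and averaging over r. -/

/-- A pair is determined by its sum and its difference, both of which divide n. -/
theorem card_filter_mul_sq_sub_sq_eq_le {F : Finset (ℕ × ℕ)} (g : ℕ → ℕ) {n D : ℕ} (hn : n ≠ 0)
    (hD : n.divisors.card ≤ D) (hF : ∀ p ∈ F, p.2 < p.1) :
    (F.filter fun p => g p.1 * (p.1 ^ 2 - p.2 ^ 2) = n).card ≤ D ^ 2 := by
  have h1 : (F.filter fun p => g p.1 * (p.1 ^ 2 - p.2 ^ 2) = n).card
      ≤ (n.divisors ×ˢ n.divisors).card := by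
    refine Finset.card_le_card_of_injOn (fun p => (p.1 + p.2, p.1 - p.2)) ?_ ?_
    · intro p hp
      have hp' := (Finset.mem_filter.mp (Finset.mem_coe.mp hp)).2
      rw [Nat.sq_sub_sq] at hp'
      simp only [Finset.coe_product, Set.mem_prod, Finset.mem_coe, Nat.mem_divisors]
      refine ⟨⟨⟨g p.1 * (p.1 - p.2), ?_⟩, hn⟩, ⟨⟨g p.1 * (p.1 + p.2), ?_⟩, hn⟩⟩
      · rw [← hp']; ring
      · rw [← hp']; ring
    · rintro ⟨a, b⟩ hp ⟨a', b'⟩ hp' heq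
      have h1 := hF _ (Finset.mem_filter.mp (Finset.mem_coe.mp hp)).1
      have h2 := hF _ (Finset.mem_filter.mp (Finset.mem_coe.mp hp')).1
      simp only [Prod.mk.injEq] at heq h1 h2 ⊢
      omega
  refine h1.trans ?_
  rw [Finset.card_product, pow_two]
  exact Nat.mul_le_mul hD hD

/-- Cauchy–Schwarz over the k fibres of g, with the pairs in a common fibre split into the diagonal
and two symmetric halves. -/
theorem sq_card_le_of_fiberwise (F : Finset ℕ) (g : ℕ → ℕ) (k : ℕ)
    (hg : ∀ r ∈ F, g r ∈ Finset.Icc 1 k) :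
    F.card ^ 2 ≤ k * (F.card + 2 *
      ((F ×ˢ F).filter fun p => g p.1 = g p.2 ∧ p.2 < p.1).card) := by
  set E := (F ×ˢ F).filter fun p => g p.1 = g p.2 with hE
  set E' := (F ×ˢ F).filter fun p => g p.1 = g p.2 ∧ p.2 < p.1 with hE'
  have h1 : F.card = ∑ i ∈ Finset.Icc 1 k, (F.filter fun r => g r = i).card :=
    Finset.card_eq_sum_card_fiberwise hg
  have h2 : E.card = ∑ i ∈ Finset.Icc 1 k, (F.filter fun r => g r = i).card ^ 2 := by
    rw [Finset.card_eq_sum_card_fiberwise (f := fun p : ℕ × ℕ => g p.1) (t := Finset.Icc 1 k)]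
    · refine Finset.sum_congr rfl fun i _ => ?_
      rw [pow_two, ← Finset.card_product]
      congr 1
      ext p
      simp only [hE, Finset.mem_filter, Finset.mem_product]
      constructor
      · rintro ⟨⟨⟨h1, h2⟩, h3⟩, h4⟩
        exact ⟨⟨h1, h4⟩, h2, h3 ▸ h4⟩
      · rintro ⟨⟨h1, h4⟩, h2, h3⟩
        exact ⟨⟨⟨h1, h2⟩, h4.trans h3.symm⟩, h4⟩
    · intro p hp
      exact hg _ (Finset.mem_product.mp (Finset.mem_filter.mp (Finset.mem_coe.mp hp)).1).1
  have h3 : F.card ^ 2 ≤ k * E.card := by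
    rw [h2]
    conv_lhs => rw [h1]
    have := sq_sum_le_card_mul_sum_sq (s := Finset.Icc 1 k)
      (f := fun i => (F.filter fun r => g r = i).card)
    simpa using this
  have h4 : E ⊆ F.diag ∪ (E' ∪ E'.image Prod.swap) := by
    rintro ⟨a, b⟩ hp
    simp only [hE, Finset.mem_filter, Finset.mem_product] at hp
    obtain ⟨⟨ha, hb⟩, hab⟩ := hp
    rcases lt_trichotomy a b with h | h | h
    · refine Finset.mem_union_right _ (Finset.mem_union_right _ (Finset.mem_image.mpr
        ⟨(b, a), ?_, rfl⟩))
      simp [hE', ha, hb, hab, h]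
    · subst h
      exact Finset.mem_union_left _ (by simp [ha])
    · refine Finset.mem_union_right _ (Finset.mem_union_left _ ?_)
      simp [hE', ha, hb, hab, h]
  have h5 : E.card ≤ F.card + 2 * E'.card := by
    refine (Finset.card_le_card h4).trans ((Finset.card_union_le _ _).trans ?_)
    rw [Finset.diag_card, two_mul]
    exact Nat.add_le_add_left ((Finset.card_union_le _ _).trans
      (Nat.add_le_add_left Finset.card_image_le _)) _
  exact h3.trans (Nat.mul_le_mul_left _ h5)

/-- Each counted r has a denominator k ≤ K with k·r²α within 4KR²/X² of an integer. Subtracting two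
such relations with the same k gives n = k(r₁² - r₂²) ≤ 4KR² with nα within 8KR²/X² of an integer.
`card_filter_near_le` counts these n, and each n arises from at most D² pairs. -/
theorem sq_card_filter_kappa_lt_le {α X R K : ℝ} (hX : 0 < X) (hR : 0 < R) (hK : 0 ≤ K)
    {q : ℕ} {a : ℤ} (hq : 0 < q) (hqa : IsCoprime (q : ℤ) a) (hα : |q * α - a| ≤ 1 / q) {D : ℕ}
    (hD : ∀ n : ℕ, (n : ℝ) ≤ 4 * K * R ^ 2 → n.divisors.card ≤ D) :
    (((dyadic R).filter fun r : ℕ => kappa ((r : ℝ) ^ 2 * α) (X / r) < K).card : ℝ) ^ 2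
      ≤ K * (((dyadic R).filter fun r : ℕ => kappa ((r : ℝ) ^ 2 * α) (X / r) < K).card
        + 2 * (D ^ 2 * ((8 * K * R ^ 2 / q + 1) * (32 * q * K * R ^ 2 / X ^ 2 + 1)))) := by
  set F := (dyadic R).filter fun r : ℕ => kappa ((r : ℝ) ^ 2 * α) (X / r) < K with hF
  have hr0 : ∀ r ∈ F, (0 : ℝ) < r := fun r hr => by
    exact_mod_cast pos_of_mem_dyadic (Finset.mem_filter.mp hr).1
  have hr2 : ∀ r ∈ F, (r : ℝ) ^ 2 ≤ 4 * R ^ 2 := fun r hr => by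
    have h1 := ((mem_dyadic hR.le r).mp (Finset.mem_filter.mp hr).1).2
    have h2 := hr0 r hr
    nlinarith
  have hex : ∀ r ∈ F, ∃ k : ℕ, k ∈ Finset.Icc 1 ⌊K⌋₊ ∧
      ∃ b : ℤ, |k * ((r : ℝ) ^ 2 * α) - b| ≤ 4 * K * R ^ 2 / X ^ 2 := by
    intro r hr
    obtain ⟨k, hk, b, hb⟩ := exists_of_kappa_lt (Finset.mem_filter.mp hr).2
    have hr' := hr0 r hr
    have h1 : 0 ≤ (X / r) ^ 2 * |k * ((r : ℝ) ^ 2 * α) - b| := by positivity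
    have h2 : (k : ℝ) ≤ K := by linarith
    refine ⟨k, Finset.mem_Icc.mpr ⟨hk, Nat.le_floor h2⟩, b, ?_⟩
    have h3 : (X / r) ^ 2 * |k * ((r : ℝ) ^ 2 * α) - b| ≤ K := by
      have : (0 : ℝ) < k := by exact_mod_cast hk
      linarith
    rw [div_pow, div_mul_eq_mul_div, div_le_iff₀ (by positivity)] at h3
    rw [le_div_iff₀ (by positivity)]
    nlinarith [hr2 r hr]
  choose! g hg z hz using hex
  have h1 := sq_card_le_of_fiberwise F g ⌊K⌋₊ hg
  set E := (F ×ˢ F).filter fun p => g p.1 = g p.2 ∧ p.2 < p.1 with hE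
  set T := (Finset.range (⌊4 * K * R ^ 2⌋₊ + 1)).filter
    fun n : ℕ => |n * α - round (n * α)| ≤ 8 * K * R ^ 2 / X ^ 2 with hT
  have hEF : ∀ p ∈ E, p.1 ∈ F ∧ p.2 ∈ F ∧ g p.1 = g p.2 ∧ p.2 < p.1 := by
    intro p hp
    obtain ⟨h2, h3, h4⟩ := Finset.mem_filter.mp hp
    exact ⟨(Finset.mem_product.mp h2).1, (Finset.mem_product.mp h2).2, h3, h4⟩
  have hpos : ∀ p ∈ E, 0 < g p.1 * (p.1 ^ 2 - p.2 ^ 2) := by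
    intro p hp
    obtain ⟨hp1, hp2, hgp, hlt⟩ := hEF p hp
    have h2 := (Finset.mem_Icc.mp (hg _ hp1)).1
    have h3 := Nat.pow_lt_pow_left hlt two_ne_zero
    exact Nat.mul_pos h2 (by omega)
  have hle : ∀ p ∈ E, ((g p.1 * (p.1 ^ 2 - p.2 ^ 2) : ℕ) : ℝ) ≤ 4 * K * R ^ 2 := by
    intro p hp
    obtain ⟨hp1, hp2, hgp, hlt⟩ := hEF p hp
    have h2 : (g p.1 : ℝ) ≤ K :=
      le_trans (by exact_mod_cast (Finset.mem_Icc.mp (hg _ hp1)).2) (Nat.floor_le hK)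
    have h3 : ((p.1 ^ 2 - p.2 ^ 2 : ℕ) : ℝ) ≤ 4 * R ^ 2 :=
      le_trans (by exact_mod_cast Nat.sub_le _ _) (hr2 _ hp1)
    push_cast only [Nat.cast_mul]
    calc (g p.1 : ℝ) * ((p.1 ^ 2 - p.2 ^ 2 : ℕ) : ℝ) ≤ K * (4 * R ^ 2) := by gcongr
      _ = _ := by ring
  have hmaps : ∀ p ∈ E, g p.1 * (p.1 ^ 2 - p.2 ^ 2) ∈ T.filter (0 < ·) := by
    intro p hp
    obtain ⟨hp1, hp2, hgp, hlt⟩ := hEF p hp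
    refine Finset.mem_filter.mpr ⟨Finset.mem_filter.mpr ⟨?_, ?_⟩, hpos p hp⟩
    · rw [Finset.mem_range, Nat.lt_succ_iff]
      exact Nat.le_floor (hle p hp)
    · refine (round_le _ (z p.1 - z p.2)).trans ?_
      have h3 := Nat.pow_le_pow_left hlt.le 2
      have h4 : ((g p.1 * (p.1 ^ 2 - p.2 ^ 2) : ℕ) : ℝ) * α - ((z p.1 - z p.2 : ℤ) : ℝ)
          = (g p.1 * ((p.1 : ℝ) ^ 2 * α) - z p.1) - (g p.2 * ((p.2 : ℝ) ^ 2 * α) - z p.2) := by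
        rw [← hgp]
        push_cast [h3]
        ring
      rw [h4]
      refine (abs_sub _ _).trans ((add_le_add (hz _ hp1) (hz _ hp2)).trans (le_of_eq ?_))
      ring
  have h2 : E.card ≤ D ^ 2 * T.card := by
    refine le_trans ?_ (Nat.mul_le_mul_left _ (Finset.card_filter_le T (0 < ·)))
    refine Finset.card_le_mul_card_image_of_maps_to hmaps _ fun n hn => ?_
    obtain ⟨hn1, hn2⟩ := Finset.mem_filter.mp hn
    refine card_filter_mul_sq_sub_sq_eq_le g hn2.ne' (hD n ?_) fun p hp => (hEF p hp).2.2.2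
    have h3 := Finset.mem_range.mp (Finset.mem_filter.mp hn1).1
    exact (Nat.le_floor_iff (by positivity)).mp (Nat.lt_succ_iff.mp h3)
  have h3 : (T.card : ℝ) ≤ (8 * K * R ^ 2 / q + 1) * (32 * q * K * R ^ 2 / X ^ 2 + 1) := by
    refine (card_filter_near_le ⌊4 * K * R ^ 2⌋₊ hq hqa hα (by positivity)).trans ?_
    gcongr ?_ * ?_
    · gcongr ?_ / _ + 1
      linarith [Nat.floor_le (by positivity : 0 ≤ 4 * K * R ^ 2)]
    · apply le_of_eq
      ring
  have h4 : (E.card : ℝ) ≤ D ^ 2 * T.card := by exact_mod_cast h2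
  calc (F.card : ℝ) ^ 2 ≤ ⌊K⌋₊ * (F.card + 2 * E.card) := by exact_mod_cast h1
    _ ≤ _ := by
      gcongr
      · exact Nat.floor_le hK
      · exact h4.trans (by gcongr)

theorem one_div_sqrt_min_le {κ W : ℝ} {J : ℕ} (hκ : 1 ≤ κ) (hW : 0 < W)
    (hJ : 2 * W < 2 ^ (J + 1)) :
    1 / √(min κ W) ≤ 1 / √W + ∑ j ∈ Finset.range J,
      if κ < 2 ^ (j + 1) then 2 / √((2 : ℝ) ^ (j + 1)) else 0 := by
  have hnn : ∀ j ∈ Finset.range J,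
      (0 : ℝ) ≤ if κ < 2 ^ (j + 1) then 2 / √((2 : ℝ) ^ (j + 1)) else 0 := by
    intro j _
    split_ifs <;> positivity
  rcases le_or_gt W κ with h | h
  · rw [min_eq_right h]
    linarith [Finset.sum_nonneg hnn]
  rw [min_eq_left h.le]
  obtain ⟨j, hj1, hj2⟩ := exists_nat_pow_near hκ (one_lt_two : (1 : ℝ) < 2)
  have hjJ : j < J := by
    have : (2 : ℝ) ^ (j + 1) < 2 ^ (J + 1) := by
      rw [pow_succ]
      linarith
    have := (pow_lt_pow_iff_right₀ (one_lt_two : (1 : ℝ) < 2)).mp this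
    omega
  have h1 := Finset.single_le_sum hnn (Finset.mem_range.mpr hjJ)
  rw [if_pos hj2] at h1
  have h2 : 1 / √κ ≤ 2 / √((2 : ℝ) ^ (j + 1)) := by
    rw [div_le_div_iff₀ (by positivity) (by positivity), one_mul]
    have : (2 : ℝ) ^ (j + 1) ≤ 2 ^ 2 * κ := by
      rw [pow_succ]
      linarith
    calc √((2 : ℝ) ^ (j + 1)) ≤ √(2 ^ 2 * κ) := Real.sqrt_le_sqrt this
      _ = 2 * √κ := by rw [Real.sqrt_mul (by norm_num), Real.sqrt_sq (by norm_num)]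
  have h3 : 0 ≤ 1 / √W := by positivity
  linarith

theorem le_add_sqrt_of_sq_le {x k d : ℝ} (hd : 0 ≤ d) (hk : 0 ≤ k) (h : x ^ 2 ≤ k * x + d) :
    x ≤ k + √d := by
  by_contra! hcon
  have h1 := Real.sq_sqrt hd
  have h2 := Real.sqrt_nonneg d
  nlinarith

theorem card_filter_kappa_lt_le {B c : ℝ} (hB : 0 < B) (hc : 0 < c) {X P R α K : ℝ}
    (hX : 0 < X) (hP : 1 ≤ P) (hPX : P ^ 4 ≤ X ^ 2) (hR : 0 < R) (hRB : R * P ^ 3 ≤ B * X)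
    (hcR : c * P ^ 2 ≤ R) (hα : ∀ q : ℕ, 0 < q → (q : ℝ) ≤ P ^ 4 → ∀ b : ℤ,
      P ^ 4 / X ^ 2 ≤ |q * α - b|) (hK : 0 < K) (hKP : K ≤ P ^ 2) {D : ℕ}
    (hD : ∀ n : ℕ, (n : ℝ) ≤ 4 * K * R ^ 2 → n.divisors.card ≤ D) :
    (((dyadic R).filter fun r : ℕ => kappa ((r : ℝ) ^ 2 * α) (X / r) < K).card : ℝ)
      ≤ (1 / c + D * √(2 * (256 * B ^ 2 + 40 + 1 / c ^ 2))) * √K * (R / P) := by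
  have hN : 0 < ⌊X ^ 2 / P ^ 4⌋₊ :=
    Nat.floor_pos.mpr ((one_le_div (by positivity)).mpr hPX)
  obtain ⟨q, a, hq, hqN, hqa, happ⟩ := exists_coprime_approx α hN
  have hq' : (0 : ℝ) < q := by exact_mod_cast hq
  have hqX : (q : ℝ) ≤ X ^ 2 / P ^ 4 := (Nat.le_floor_iff (by positivity)).mp hqN
  have hqP : P ^ 4 < q := by
    by_contra! hcon
    refine absurd (hα q hq hcon a) (not_le.mpr (happ.trans_lt ?_))
    rw [div_lt_div_iff₀ (by positivity) (by positivity)]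
    have := Nat.lt_floor_add_one (X ^ 2 / P ^ 4)
    rw [div_lt_iff₀ (by positivity)] at this
    linarith
  have happ' : |q * α - a| ≤ 1 / q := by
    refine happ.trans (one_div_le_one_div_of_le hq' ?_)
    have : (q : ℝ) ≤ ⌊X ^ 2 / P ^ 4⌋₊ := by exact_mod_cast hqN
    linarith
  have h1 := sq_card_filter_kappa_lt_le hX hR hK.le hq hqa happ' hD
  set n : ℝ := (((dyadic R).filter fun r : ℕ => kappa ((r : ℝ) ^ 2 * α) (X / r) < K).card : ℝ)
  set E := 256 * B ^ 2 + 40 + 1 / c ^ 2 with hE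
  have hP0 : 0 < P := by linarith
  have hV : (8 * K * R ^ 2 / q + 1) * (32 * q * K * R ^ 2 / X ^ 2 + 1) ≤ E * (R / P) ^ 2 := by
    have e1 : (8 * K * R ^ 2 / q + 1) * (32 * q * K * R ^ 2 / X ^ 2 + 1)
        = 256 * (K * R / X) ^ 2 * R ^ 2 + 8 * (K / q) * R ^ 2 + 32 * (q / X ^ 2 * K) * R ^ 2
          + 1 := by
      field_simp
      ring
    have e2 : K * R / X ≤ B / P := by
      rw [div_le_div_iff₀ hX hP0]
      calc K * R * P ≤ P ^ 2 * R * P := by gcongr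
        _ = R * P ^ 3 := by ring
        _ ≤ B * X := hRB
    have e3 : K / q ≤ (1 / P) ^ 2 := by
      calc K / q ≤ P ^ 2 / P ^ 4 := by gcongr
        _ = _ := by field_simp
    have e4 : q / X ^ 2 * K ≤ (1 / P) ^ 2 := by
      calc q / X ^ 2 * K ≤ (X ^ 2 / P ^ 4) / X ^ 2 * P ^ 2 := by gcongr
        _ = _ := by field_simp
    have e5 : 1 ≤ (1 / c) ^ 2 * (R / P) ^ 2 := by
      rw [← mul_pow]
      refine one_le_pow₀ ?_
      rw [one_div_mul_eq_div, div_div, one_le_div (by positivity)]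
      calc P * c ≤ c * P ^ 2 := by nlinarith [mul_pos hc hP0]
        _ ≤ R := hcR
    rw [e1]
    calc _ ≤ 256 * (B / P) ^ 2 * R ^ 2 + 8 * (1 / P) ^ 2 * R ^ 2 + 32 * (1 / P) ^ 2 * R ^ 2
          + (1 / c) ^ 2 * (R / P) ^ 2 := by gcongr
      _ = _ := by
        rw [hE]
        ring
  have hE0 : 0 < E := by positivity
  have h2 : n ^ 2 ≤ K * n + 2 * K * D ^ 2 * E * (R / P) ^ 2 := by
    refine h1.trans ?_
    calc K * (n + 2 * (D ^ 2 * ((8 * K * R ^ 2 / q + 1) * (32 * q * K * R ^ 2 / X ^ 2 + 1))))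
        ≤ K * (n + 2 * (D ^ 2 * (E * (R / P) ^ 2))) := by gcongr
      _ = _ := by ring
  have h3 := le_add_sqrt_of_sq_le (by positivity) hK.le h2
  have h4 : √(2 * K * D ^ 2 * E * (R / P) ^ 2) = D * √(2 * E) * √K * (R / P) := by
    rw [show 2 * K * (D : ℝ) ^ 2 * E * (R / P) ^ 2 = (D * (R / P)) ^ 2 * ((2 * E) * K) by ring,
      Real.sqrt_mul (by positivity), Real.sqrt_sq (by positivity), Real.sqrt_mul (by positivity)]
    ring
  have h5 : K ≤ 1 / c * √K * (R / P) := by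
    have s1 : √K ≤ P := by
      rw [← Real.sqrt_sq hP0.le]
      exact Real.sqrt_le_sqrt hKP
    have s2 : P ≤ 1 / c * (R / P) := by
      rw [one_div_mul_eq_div, div_div, le_div_iff₀ (by positivity)]
      linarith
    calc K = √K * √K := (Real.mul_self_sqrt hK.le).symm
      _ ≤ √K * (1 / c * (R / P)) := by
        gcongr
        exact s1.trans s2
      _ = _ := by ring
  rw [h4] at h3
  calc n ≤ _ := h3
    _ ≤ 1 / c * √K * (R / P) + D * √(2 * E) * √K * (R / P) := by gcongr
    _ = _ := by ring

theorem one_div_sqrt_sq_half_le {P : ℝ} (hP : 0 < P) : 1 / √(P ^ 2 / 2) ≤ 3 / P := by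
  rw [Real.sqrt_div (by positivity), Real.sqrt_sq hP.le, one_div_div]
  gcongr
  exact Real.sqrt_le_iff.mpr ⟨by norm_num, by norm_num⟩

/-- In a dyadic decomposition of κ, the growth √K of the count cancels the weight 1/√K, so each of
the O(log X) scales contributes about R/P. Capping at P²/2 rather than P² keeps every threshold K =
2^{j+1} at most P². -/
theorem sum_one_div_sqrt_min_kappa_le_of_minor {δ B c : ℝ} (hδ : 0 < δ) (hB : 0 < B)
    (hc : 0 < c) :
    ∃ C : ℝ, 0 ≤ C ∧ ∀ X P R α : ℝ, 1 ≤ X → 1 ≤ P → P ^ 2 ≤ X → 0 < R → R * P ^ 3 ≤ B * X →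
      c * P ^ 2 ≤ R → (∀ q : ℕ, 0 < q → (q : ℝ) ≤ P ^ 4 → ∀ b : ℤ,
        P ^ 4 / X ^ 2 ≤ |q * α - b|) →
      ∑ r ∈ dyadic R, 1 / √(min (kappa ((r : ℝ) ^ 2 * α) (X / r)) (P ^ 2 / 2))
        ≤ C * X ^ δ * (R / P) := by
  obtain ⟨c₁, hc₁, hdiv⟩ := exists_card_divisors_le (by positivity : 0 < δ / 4)
  obtain ⟨c₂, hc₂, hJb⟩ := exists_add_one_le_mul_two_pow_rpow (by positivity : 0 < δ / 2)
  set G := √(2 * (256 * B ^ 2 + 40 + 1 / c ^ 2)) with hG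
  set H := 1 / c + c₁ * (4 * B ^ 2) ^ (δ / 4) * G with hH
  refine ⟨6 + 2 * c₂ * H, by positivity, fun X P R α hX hP hPX hR hRB hcR hα => ?_⟩
  have hX0 : 0 < X := by linarith
  have hP0 : 0 < P := by linarith
  have hPX4 : P ^ 4 ≤ X ^ 2 := by
    calc P ^ 4 = (P ^ 2) ^ 2 := by ring
      _ ≤ X ^ 2 := by gcongr
  obtain ⟨J, hJ1, hJ2⟩ := exists_nat_pow_near (one_le_pow₀ hP : 1 ≤ P ^ 2)
    (one_lt_two : (1 : ℝ) < 2)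
  have hKR : P ^ 2 * R ^ 2 ≤ B ^ 2 * X ^ 2 := by
    calc P ^ 2 * R ^ 2 ≤ P ^ 6 * R ^ 2 := by
          gcongr
          norm_num
      _ = (R * P ^ 3) ^ 2 := by ring
      _ ≤ (B * X) ^ 2 := by gcongr
      _ = _ := by ring
  have hXδ : 1 ≤ X ^ (δ / 2) := Real.one_le_rpow hX (by positivity)
  set D := ⌊c₁ * (4 * B ^ 2) ^ (δ / 4) * X ^ (δ / 2)⌋₊ with hD
  have hDle : (D : ℝ) ≤ c₁ * (4 * B ^ 2) ^ (δ / 4) * X ^ (δ / 2) := Nat.floor_le (by positivity)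
  have hcard : ∀ K : ℝ, 0 < K → K ≤ P ^ 2 →
      (((dyadic R).filter fun r : ℕ => kappa ((r : ℝ) ^ 2 * α) (X / r) < K).card : ℝ)
        ≤ H * X ^ (δ / 2) * √K * (R / P) := by
    intro K hK hKP
    refine (card_filter_kappa_lt_le hB hc hX0 hP hPX4 hR hRB hcR hα hK hKP (D := D) ?_).trans ?_
    · intro n hn
      refine Nat.le_floor ((hdiv n).trans ?_)
      rw [mul_assoc]
      gcongr
      have : (n : ℝ) ≤ 4 * B ^ 2 * X ^ 2 := by nlinarith [mul_le_mul_of_nonneg_right hKP (sq_nonneg R)]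
      calc (n : ℝ) ^ (δ / 4) ≤ (4 * B ^ 2 * X ^ 2) ^ (δ / 4) := by gcongr
        _ = _ := by
          rw [Real.mul_rpow (by positivity) (by positivity), ← Real.rpow_natCast X 2,
            ← Real.rpow_mul hX0.le]
          congr 2
          push_cast
          ring
    · gcongr
      calc 1 / c + D * G ≤ 1 / c * X ^ (δ / 2) + c₁ * (4 * B ^ 2) ^ (δ / 4) * X ^ (δ / 2) * G := by
            gcongr
            exact le_mul_of_one_le_right (by positivity) hXδ
        _ = _ := by rw [hH]; ring
  have hdy : ((dyadic R).card : ℝ) ≤ 2 * R := by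
    rw [dyadic, Nat.card_Ioc]
    refine le_trans ?_ (Nat.floor_le (by positivity : 0 ≤ 2 * R))
    exact_mod_cast Nat.sub_le _ _
  have hsqrt := one_div_sqrt_sq_half_le hP0
  calc ∑ r ∈ dyadic R, 1 / √(min (kappa ((r : ℝ) ^ 2 * α) (X / r)) (P ^ 2 / 2))
      ≤ ∑ r ∈ dyadic R, (1 / √(P ^ 2 / 2) + ∑ j ∈ Finset.range J,
        if kappa ((r : ℝ) ^ 2 * α) (X / r) < 2 ^ (j + 1)
          then 2 / √((2 : ℝ) ^ (j + 1)) else 0) :=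
        Finset.sum_le_sum fun r _ => one_div_sqrt_min_le (one_le_kappa _ _) (by positivity)
          (by linarith)
    _ = (dyadic R).card * (1 / √(P ^ 2 / 2)) + ∑ j ∈ Finset.range J,
        ((dyadic R).filter fun r : ℕ => kappa ((r : ℝ) ^ 2 * α) (X / r) < 2 ^ (j + 1)).card
          * (2 / √((2 : ℝ) ^ (j + 1))) := by
        rw [Finset.sum_add_distrib, Finset.sum_const, nsmul_eq_mul, Finset.sum_comm]
        congr 1
        refine Finset.sum_congr rfl fun j _ => ?_
        rw [← Finset.sum_filter, Finset.sum_const, nsmul_eq_mul]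
    _ ≤ 2 * R * (3 / P) + ∑ j ∈ Finset.range J, 2 * (H * X ^ (δ / 2) * (R / P)) := by
        refine add_le_add (by gcongr) (Finset.sum_le_sum fun j hj => ?_)
        have hjJ : (2 : ℝ) ^ (j + 1) ≤ P ^ 2 :=
          (pow_le_pow_right₀ one_le_two (Finset.mem_range.mp hj)).trans hJ1
        refine (mul_le_mul_of_nonneg_right (hcard _ (by positivity) hjJ)
          (by positivity)).trans (le_of_eq ?_)
        have : 0 < √((2 : ℝ) ^ (j + 1)) := by positivity
        field_simp
    _ = 6 * (R / P) + J * (2 * (H * X ^ (δ / 2) * (R / P))) := by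
        rw [Finset.sum_const, Finset.card_range, nsmul_eq_mul]
        ring
    _ ≤ 6 * X ^ δ * (R / P) + c₂ * X ^ (δ / 2) * (2 * (H * X ^ (δ / 2) * (R / P))) := by
        have hJX : (J : ℝ) ≤ c₂ * X ^ (δ / 2) := by
          have h1 := hJb J
          have h2 : ((2 : ℝ) ^ J) ^ (δ / 2) ≤ X ^ (δ / 2) := by
            gcongr
            exact hJ1.trans hPX
          have h3 := mul_le_mul_of_nonneg_left h2 (by linarith : 0 ≤ c₂)
          linarith
        gcongr
        exact le_mul_of_one_le_right (by norm_num) (Real.one_le_rpow hX hδ.le)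
    _ = _ := by
        have : X ^ δ = X ^ (δ / 2) * X ^ (δ / 2) := by
          rw [← Real.rpow_add hX0]
          ring_nf
        rw [this]
        ring

/-! ### The minor arc condition and the final assembly. -/

theorem le_abs_mul_sub_of_mem_minorArcs {σ X α : ℝ} (hσ0 : 0 < σ) (hσ1 : σ < 1 / 6) (hX : 1 ≤ X)
    (hα : α ∈ minorArcs σ X) {q : ℕ} (hq : 0 < q) (hqQ : (q : ℝ) ≤ X ^ (4 * σ)) (b : ℤ) :
    X ^ (4 * σ) / X ^ 2 ≤ |q * α - b| := by
  obtain ⟨⟨hα1, hα2⟩, hmaj⟩ := hα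
  set Q := X ^ (4 * σ) with hQ
  have hX0 : 0 < X := by linarith
  have hQ1 : 1 ≤ Q := Real.one_le_rpow hX (by positivity)
  have hQX : Q ≤ X ^ 2 := by
    rw [hQ, ← Real.rpow_natCast X 2]
    exact Real.rpow_le_rpow_of_exponent_le hX (by push_cast; linarith)
  have hQX1 : Q / X ^ 2 ≤ 1 := (div_le_one (by positivity)).mpr hQX
  have hQX0 : 0 < Q / X ^ 2 := by positivity
  have hq' : (1 : ℝ) ≤ q := by exact_mod_cast hq
  have hq0 : (0 : ℝ) < q := by linarith
  by_contra! hlt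
  obtain ⟨hl1, hl2⟩ := abs_lt.mp hlt
  have hb0 : 0 < b := by
    have : (0 : ℝ) < b := by nlinarith
    exact_mod_cast this
  lift b to ℕ using hb0.le
  have hb0' : 0 < b := by exact_mod_cast hb0
  rw [Int.cast_natCast] at hl1 hl2 hlt
  -- If b > q, then α ≥ 1 and α lies in the arc around 1/1. Otherwise b/q reduces to an admissible
  -- fraction, and dividing by the gcd only improves the approximation.
  rcases Nat.lt_or_ge q b with hqb | hbq
  · have hqb' : (q : ℝ) + 1 ≤ b := by exact_mod_cast hqb
    refine hmaj ⟨1, 1, by exact_mod_cast hQ1, le_rfl, le_rfl, Nat.coprime_one_left 1, ?_⟩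
    have : 1 ≤ α := by
      by_contra! hcon
      nlinarith
    simp only [Nat.cast_one, div_one, one_mul, Set.mem_Icc]
    constructor <;> linarith
  · obtain ⟨g, q₀, b₀, hg, hcop, hqe, hbe⟩ : ∃ g q₀ b₀ : ℕ, 0 < g ∧ Nat.Coprime q₀ b₀ ∧
        q = q₀ * g ∧ b = b₀ * g := by
      obtain ⟨q₀, b₀, h1, h2, h3⟩ := Nat.exists_coprime q b
      exact ⟨_, q₀, b₀, Nat.gcd_pos_of_pos_left b hq, h1, h2, h3⟩
    have hq₀ : 0 < q₀ := Nat.pos_of_ne_zero (by rintro rfl; simp at hqe; omega)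
    have hb₀ : 0 < b₀ := Nat.pos_of_ne_zero (by rintro rfl; simp at hbe; omega)
    have hle : q₀ ≤ q := by rw [hqe]; exact Nat.le_mul_of_pos_right _ hg
    have hq₀' : (0 : ℝ) < q₀ := by exact_mod_cast hq₀
    have hg' : (1 : ℝ) ≤ g := by exact_mod_cast hg
    refine hmaj ⟨q₀, b₀, le_trans (by exact_mod_cast hle) hqQ, hb₀, ?_, hcop.symm, ?_⟩
    · rw [hqe, hbe] at hbq
      exact Nat.le_of_mul_le_mul_right hbq hg
    · have h1 : |(q₀ : ℝ) * α - b₀| ≤ Q / X ^ 2 := by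
        have h2 : (q : ℝ) * α - b = g * (q₀ * α - b₀) := by
          rw [hqe, hbe]; push_cast; ring
        rw [h2, abs_mul, abs_of_nonneg (by positivity)] at hlt
        nlinarith [abs_nonneg ((q₀ : ℝ) * α - b₀)]
      have h2 : |α - b₀ / q₀| ≤ Q / (q₀ * X ^ 2) := by
        have h3 : α - b₀ / q₀ = (q₀ * α - b₀) / q₀ := by field_simp
        rw [h3, abs_div, abs_of_pos hq₀', div_le_iff₀ hq₀']
        refine h1.trans (le_of_eq ?_)
        field_simp
      obtain ⟨h4, h5⟩ := abs_le.mp h2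
      exact ⟨by linarith, by linarith⟩

theorem sum_one_div_sqrt_min_kappa_le_rpow {δ : ℝ} (hδ : 0 < δ) :
    ∃ C : ℝ, 0 ≤ C ∧ ∀ X β Y S W : ℝ, 1 ≤ X → 0 < Y → Y ≤ X → 0 < S → 0 < W →
      S ^ 2 * W ≤ Y / 10 →
      ∑ s ∈ dyadic S, 1 / √(min (kappa ((s : ℝ) ^ 2 * β) (Y / s)) W)
        ≤ C * X ^ δ * S * (1 / √(min (kappa β Y) W)) := by
  obtain ⟨c, hc, hdiv⟩ := exists_card_divisors_le hδ
  refine ⟨2 * (c * 2 ^ δ), by positivity, fun X β Y S W hX hY hYX hS hW h => ?_⟩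
  obtain ⟨q, hq, hsum⟩ := sum_one_div_sqrt_min_kappa_le (β := β) hY hS hW h
  refine hsum.trans ?_
  have h1 : (q.divisors.card : ℝ) ≤ c * 2 ^ δ * X ^ δ := by
    refine (hdiv q).trans ?_
    rw [mul_assoc, ← Real.mul_rpow (by norm_num) (by linarith)]
    gcongr
    linarith
  calc 2 * S * q.divisors.card * (1 / √(min (kappa β Y) W))
      ≤ 2 * S * (c * 2 ^ δ * X ^ δ) * (1 / √(min (kappa β Y) W)) := by gcongr
    _ = _ := by ring

theorem sum_dyadic_one_div_sqrt_min_kappa_le {δ B : ℝ} (hδ : 0 < δ) (hB : 0 < B) :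
    ∃ C : ℝ, 0 ≤ C ∧ ∀ X P R α : ℝ, 1 ≤ X → 1 ≤ P → P ^ 6 ≤ X → 0 < R → R * P ^ 3 ≤ B * X →
      (∀ q : ℕ, 0 < q → (q : ℝ) ≤ P ^ 4 → ∀ b : ℤ, P ^ 4 / X ^ 2 ≤ |q * α - b|) →
      ∑ r ∈ dyadic R, 1 / √(min (kappa ((r : ℝ) ^ 2 * α) (X / r)) (P ^ 2 / 2))
        ≤ C * X ^ δ * (R / P) := by
  obtain ⟨C₁, hC₁, h₁⟩ := sum_one_div_sqrt_min_kappa_le_rpow hδ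
  obtain ⟨C₂, hC₂, h₂⟩ := sum_one_div_sqrt_min_kappa_le_of_minor hδ hB
    (by norm_num : (0 : ℝ) < 1 / 3)
  refine ⟨C₁ * 3 + C₂, by positivity, fun X P R α hX hP hPX hR hRB hα => ?_⟩
  have hX0 : 0 < X := by linarith
  have hP0 : 0 < P := by linarith
  have hRP : 0 < R / P := by positivity
  rcases le_or_gt (R ^ 2 * (P ^ 2 / 2)) (X / 10) with hcase | hcase
  · refine (h₁ X α X R (P ^ 2 / 2) hX hX0 le_rfl hR (by positivity) hcase).trans ?_
    have hκ : P ^ 2 / 2 ≤ kappa α X := by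
      refine le_kappa fun q hq b => ?_
      have hq' : (0 : ℝ) < q := by exact_mod_cast hq
      have hP24 : P ^ 2 ≤ P ^ 4 := pow_le_pow_right₀ hP (by norm_num)
      have hPp : 0 < P ^ 2 := by positivity
      rcases le_or_gt (q : ℝ) (P ^ 4) with h | h
      · have h3 := hα q hq h b
        rw [div_le_iff₀ (by positivity)] at h3
        linarith
      · have : 0 ≤ X ^ 2 * |q * α - b| := by positivity
        linarith
    rw [min_eq_right hκ]
    calc C₁ * X ^ δ * R * (1 / √(P ^ 2 / 2)) ≤ C₁ * X ^ δ * R * (3 / P) :=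
          mul_le_mul_of_nonneg_left (one_div_sqrt_sq_half_le hP0) (by positivity)
      _ = C₁ * 3 * (X ^ δ * (R / P)) := by ring
      _ ≤ (C₁ * 3 + C₂) * (X ^ δ * (R / P)) := by
          gcongr
          linarith
      _ = _ := by ring
  · have hPX2 : P ^ 2 ≤ X := (pow_le_pow_right₀ hP (by norm_num)).trans hPX
    -- Here P⁶ ≤ X < 5R²P², so P⁴ < 5R² < 9R².
    have hcR : 1 / 3 * P ^ 2 ≤ R := by
      have h3 : P ^ 6 < 5 * (R ^ 2 * P ^ 2) := by linarith
      have h4 : P ^ 4 < 5 * R ^ 2 := by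
        have hPp : 0 < P ^ 2 := by positivity
        refine lt_of_mul_lt_mul_right ?_ hPp.le
        calc P ^ 4 * P ^ 2 = P ^ 6 := by ring
          _ < 5 * (R ^ 2 * P ^ 2) := h3
          _ = _ := by ring
      refine abs_le_of_sq_le_sq' ?_ hR.le |>.2
      nlinarith
    refine (h₂ X P R α hX hP hPX2 hR hRB hcR hα).trans ?_
    gcongr
    linarith

theorem sum_norm_sum_e_le {δ B : ℝ} (hδ : 0 < δ) (hB : 1 ≤ B) :
    ∃ C : ℝ, 0 ≤ C ∧ ∀ X P R S α : ℝ, 1 ≤ X → 1 ≤ P → P ^ 6 ≤ X → 0 < R → 0 < S →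
      R * P ^ 3 ≤ B * X → R * S ^ 2 * P ^ 2 ≤ X / 10 → R * S * P ^ 2 ≤ B * X →
      (∀ q : ℕ, 0 < q → (q : ℝ) ≤ P ^ 4 → ∀ b : ℤ, P ^ 4 / X ^ 2 ≤ |q * α - b|) →
      ∑ r ∈ dyadic R, ∑ s ∈ dyadic S,
        ‖∑ m ∈ dyadic (X / (r * s)), e (α * (r : ℝ) ^ 2 * (s : ℝ) ^ 2 * (m : ℝ) ^ 2)‖
        ≤ C * X ^ (3 * δ) * (X / P) := by
  obtain ⟨C₁, hC₁, h₁⟩ := norm_sum_dyadic_e_sq_le hδ (by positivity : (0 : ℝ) ≤ 2 * B)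
  obtain ⟨C₂, hC₂, h₂⟩ := sum_one_div_sqrt_min_kappa_le_rpow hδ
  obtain ⟨C₃, hC₃, h₃⟩ := sum_dyadic_one_div_sqrt_min_kappa_le hδ (by linarith : 0 < B)
  refine ⟨C₁ * C₂ * C₃, by positivity, fun X P R S α hX hP hPX hR hS hRB hRS hRSB hα => ?_⟩
  have hX0 : 0 < X := by linarith
  have hP0 : 0 < P := by linarith
  -- The factor 1/2 offsets r ≤ 2R: the hypothesis on RS²P² then gives exactly S²W ≤ (X/r)/10.
  set W := P ^ 2 / 2 with hW
  have hW0 : 0 < W := by positivity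
  have hinner : ∀ r ∈ dyadic R, ∀ s ∈ dyadic S,
      ‖∑ m ∈ dyadic (X / (r * s)), e (α * (r : ℝ) ^ 2 * (s : ℝ) ^ 2 * (m : ℝ) ^ 2)‖
      ≤ C₁ * X ^ δ * (X / (R * S)) *
        (1 / √(min (kappa ((s : ℝ) ^ 2 * ((r : ℝ) ^ 2 * α)) (X / r / s)) W)) := by
    intro r hr s hs
    have hr0 : (1 : ℝ) ≤ r := by exact_mod_cast pos_of_mem_dyadic hr
    have hs0 : (1 : ℝ) ≤ s := by exact_mod_cast pos_of_mem_dyadic hs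
    obtain ⟨hr1, hr2⟩ := (mem_dyadic hR.le r).mp hr
    obtain ⟨hs1, hs2⟩ := (mem_dyadic hS.le s).mp hs
    have hrs : (r : ℝ) * s ≤ 2 * R * (2 * S) := by gcongr
    have hM : X / (r * s) ≤ X := div_le_self hX0.le (one_le_mul_of_one_le_of_one_le hr0 hs0)
    have hWM : W ≤ 2 * B * (X / (r * s)) := by
      rw [← mul_div_assoc, le_div_iff₀ (by positivity)]
      calc W * (r * s) ≤ W * (2 * R * (2 * S)) := by gcongr
        _ = 2 * (R * S * P ^ 2) := by rw [hW]; ring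
        _ ≤ 2 * (B * X) := by gcongr
        _ = _ := by ring
    have h4 := h₁ X ((s : ℝ) ^ 2 * ((r : ℝ) ^ 2 * α)) (X / (r * s)) W (by positivity) hM hW0 hWM
    rw [div_div]
    have h5 : ∀ m : ℕ, α * (r : ℝ) ^ 2 * (s : ℝ) ^ 2 * (m : ℝ) ^ 2
        = (s : ℝ) ^ 2 * ((r : ℝ) ^ 2 * α) * (m : ℝ) ^ 2 := fun m => by ring
    simp only [h5]
    refine h4.trans ?_
    gcongr
  calc _ ≤ ∑ r ∈ dyadic R, ∑ s ∈ dyadic S, C₁ * X ^ δ * (X / (R * S)) *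
        (1 / √(min (kappa ((s : ℝ) ^ 2 * ((r : ℝ) ^ 2 * α)) (X / r / s)) W)) :=
        Finset.sum_le_sum fun r hr => Finset.sum_le_sum fun s hs => hinner r hr s hs
    _ ≤ ∑ r ∈ dyadic R, C₁ * X ^ δ * (X / (R * S)) * (C₂ * X ^ δ * S *
          (1 / √(min (kappa ((r : ℝ) ^ 2 * α) (X / r)) W))) := by
        refine Finset.sum_le_sum fun r hr => ?_
        rw [← Finset.mul_sum]
        have hr0 : (1 : ℝ) ≤ r := by exact_mod_cast pos_of_mem_dyadic hr
        have hr2 := ((mem_dyadic hR.le r).mp hr).2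
        gcongr
        refine h₂ X _ (X / r) S W hX (by positivity) (div_le_self hX0.le hr0) hS hW0 ?_
        rw [div_div, le_div_iff₀ (by positivity)]
        calc S ^ 2 * W * (r * 10) ≤ S ^ 2 * W * (2 * R * 10) := by gcongr
          _ = 10 * (R * S ^ 2 * P ^ 2) := by rw [hW]; ring
          _ ≤ X := by linarith
    _ = C₁ * X ^ δ * (X / (R * S)) * (C₂ * X ^ δ * S) *
          ∑ r ∈ dyadic R, 1 / √(min (kappa ((r : ℝ) ^ 2 * α) (X / r)) W) := by
        rw [Finset.mul_sum]
        refine Finset.sum_congr rfl fun r _ => ?_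
        ring
    _ ≤ C₁ * X ^ δ * (X / (R * S)) * (C₂ * X ^ δ * S) * (C₃ * X ^ δ * (R / P)) := by
        gcongr
        exact h₃ X P R α hX hP hPX hR hRB hα
    _ = _ := by
        rw [show 3 * δ = δ + δ + δ by ring, Real.rpow_add hX0, Real.rpow_add hX0]
        field_simp

end TripleSum

theorem lemma3p2 (σ : ℝ) (hσ0 : 0 < σ) (hσ1 : σ < 1 / 6) (ε : ℝ) (hε : 0 < ε) (A B : ℝ) :
    ∃ C : ℝ, ∀ (X R S α : ℝ) (ξ : ℕ → ℕ → ℂ),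
      1 ≤ X → 0 < R → 0 < S →
      α ∈ TripleSum.minorArcs σ X →
      (∀ r ∈ TripleSum.dyadic R, ∀ s ∈ TripleSum.dyadic S,
        ‖ξ r s‖ ≤ A * ((r : ℝ) * (s : ℝ)) ^ ε) →
      R ≤ B * X ^ (1 - 3 * σ) →
      R * S ^ 2 ≤ 0.1 * X ^ (1 - 2 * σ) →
      ‖TripleSum.tripleSum α X R S ξ‖ ≤ C * X ^ (1 - σ + ε) := by
  set B₁ := max B 1 with hB₁
  have hB1 : 1 ≤ B₁ := le_max_right _ _
  obtain ⟨C, hC, hmain⟩ := TripleSum.sum_norm_sum_e_le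
    -- With this δ, X^{3δ} = X^{2σε}, exactly the saving in (X/P²)^ε = X^{ε - 2σε}.
    (by positivity : 0 < 2 * σ * ε / 3) hB1
  refine ⟨|A| * (4 * B₁) ^ ε * C, fun X R S α ξ hX hR hS hα hξ hRX hRSX => ?_⟩
  have hX0 : 0 < X := by linarith
  set P := X ^ σ with hP
  have hP1 : 1 ≤ P := Real.one_le_rpow hX hσ0.le
  have hP0 : 0 < P := by linarith
  have hpow : ∀ n : ℕ, P ^ n = X ^ (n * σ) := fun n => by
    rw [hP, ← Real.rpow_natCast, ← Real.rpow_mul hX0.le, mul_comm]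
  have hP6 : P ^ 6 ≤ X := by
    rw [hpow]
    calc X ^ (((6 : ℕ) : ℝ) * σ) ≤ X ^ (1 : ℝ) :=
          Real.rpow_le_rpow_of_exponent_le hX (by push_cast; linarith)
      _ = X := Real.rpow_one X
  have hcancel : ∀ n : ℕ, X ^ (1 - n * σ) * P ^ n = X := fun n => by
    rw [hpow, ← Real.rpow_add hX0, sub_add_cancel, Real.rpow_one]
  have hRB : R * P ^ 3 ≤ B₁ * X := by
    calc R * P ^ 3 ≤ B₁ * X ^ (1 - ((3 : ℕ) : ℝ) * σ) * P ^ 3 := by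
          gcongr
          refine hRX.trans ?_
          push_cast
          gcongr
          exact le_max_left _ _
      _ = B₁ * X := by rw [mul_assoc, hcancel]
  have hRS2 : R * S ^ 2 * P ^ 2 ≤ X / 10 := by
    calc R * S ^ 2 * P ^ 2 ≤ 0.1 * X ^ (1 - ((2 : ℕ) : ℝ) * σ) * P ^ 2 :=
          mul_le_mul_of_nonneg_right (by exact_mod_cast hRSX) (by positivity)
      _ = X / 10 := by rw [mul_assoc, hcancel]; ring
  -- The square is at most the product of the bounds for RP³ and RS²P², with a factor P ≥ 1 to
  -- spare.
  have hRS : R * S * P ^ 2 ≤ B₁ * X := by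
    refine abs_le_of_sq_le_sq' ?_ (by positivity) |>.2
    calc (R * S * P ^ 2) ^ 2 = (R ^ 2 * S ^ 2 * P ^ 4) * 1 := by ring
      _ ≤ (R ^ 2 * S ^ 2 * P ^ 4) * P := by gcongr
      _ = (R * P ^ 3) * (R * S ^ 2 * P ^ 2) := by ring
      _ ≤ (B₁ * X) * (X / 10) := by gcongr
      _ ≤ (B₁ * X) * (B₁ * X) := by gcongr; nlinarith
      _ = _ := by ring
  have hminor : ∀ q : ℕ, 0 < q → (q : ℝ) ≤ P ^ 4 → ∀ b : ℤ, P ^ 4 / X ^ 2 ≤ |q * α - b| := by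
    have h4 : P ^ 4 = X ^ (4 * σ) := by rw [hpow]; norm_num
    rw [h4]
    exact fun q hq hqQ b => TripleSum.le_abs_mul_sub_of_mem_minorArcs hσ0 hσ1 hX hα hq hqQ b
  have hsum := hmain X P R S α hX hP1 hP6 hR hS hRB hRS2 hRS hminor
  have hcoef : ∀ r ∈ TripleSum.dyadic R, ∀ s ∈ TripleSum.dyadic S,
      ‖ξ r s‖ ≤ |A| * ((4 * B₁) ^ ε * X ^ (ε - 2 * σ * ε)) := by
    intro r hr s hs
    have hr2 := ((TripleSum.mem_dyadic hR.le r).mp hr).2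
    have hs2 := ((TripleSum.mem_dyadic hS.le s).mp hs).2
    have h1 : (r : ℝ) * s ≤ 4 * B₁ * (X / P ^ 2) := by
      calc (r : ℝ) * s ≤ 2 * R * (2 * S) := by gcongr
        _ = 4 * (R * S * P ^ 2) / P ^ 2 := by field_simp; ring
        _ ≤ 4 * (B₁ * X) / P ^ 2 := by gcongr
        _ = _ := by ring
    have h2 : (X / P ^ 2) ^ ε = X ^ (ε - 2 * σ * ε) := by
      rw [hpow, ← Real.rpow_one_sub' hX0.le, ← Real.rpow_mul hX0.le]
      · congr 1
        push_cast
        ring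
      · push_cast
        linarith
    refine (hξ r hr s hs).trans ?_
    calc A * ((r : ℝ) * s) ^ ε ≤ |A| * (4 * B₁ * (X / P ^ 2)) ^ ε := by
          gcongr
          exact le_abs_self A
      _ = _ := by rw [Real.mul_rpow (by positivity) (by positivity), h2]
  have hexp : X ^ (ε - 2 * σ * ε) * (X ^ (3 * (2 * σ * ε / 3)) * (X / P)) = X ^ (1 - σ + ε) := by
    rw [hP, ← Real.rpow_one_sub' hX0.le (by linarith), ← Real.rpow_add hX0, ← Real.rpow_add hX0]
    congr 1
    ring
  calc ‖TripleSum.tripleSum α X R S ξ‖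
      ≤ ∑ r ∈ TripleSum.dyadic R, ∑ s ∈ TripleSum.dyadic S,
        |A| * ((4 * B₁) ^ ε * X ^ (ε - 2 * σ * ε)) *
          ‖∑ m ∈ TripleSum.dyadic (X / (r * s)),
            TripleSum.e (α * (r : ℝ) ^ 2 * (s : ℝ) ^ 2 * (m : ℝ) ^ 2)‖ := by
        rw [TripleSum.tripleSum]
        refine (norm_sum_le _ _).trans (Finset.sum_le_sum fun r hr => ?_)
        refine (norm_sum_le _ _).trans (Finset.sum_le_sum fun s hs => ?_)
        rw [← Finset.mul_sum, norm_mul]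
        gcongr
        exact hcoef r hr s hs
    _ = |A| * ((4 * B₁) ^ ε * X ^ (ε - 2 * σ * ε)) *
        ∑ r ∈ TripleSum.dyadic R, ∑ s ∈ TripleSum.dyadic S,
          ‖∑ m ∈ TripleSum.dyadic (X / (r * s)),
            TripleSum.e (α * (r : ℝ) ^ 2 * (s : ℝ) ^ 2 * (m : ℝ) ^ 2)‖ := by
        simp only [Finset.mul_sum]
    _ ≤ |A| * ((4 * B₁) ^ ε * X ^ (ε - 2 * σ * ε)) *
        (C * X ^ (3 * (2 * σ * ε / 3)) * (X / P)) := by gcongr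
    _ = _ := by
        rw [← hexp]
        ring
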